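/- **Theorem 3 (generalized Darboux transformation gDT-I).** Let $W\subseteq\mathbb R^2$ be open and let $u,v:W\to\mathbb C$ be a smooth solution of the Kaup–Newell system $$ {\rm i}u_t+u_{xx}-{\rm i}(u^2v)_x=0,\qquad -{\rm i}v_t+v_{xx}+{\rm i}(uv^2)_x=0, $$ with Lax pair $\Phi_x=U\Phi$, $\Phi_t=V\Phi$, $$U=-\tfrac{\rm i}{\zeta^2}\sigma_3+\tfrac1\zeta Q,\quad V=-\tfrac{2{\rm i}}{\zeta^4}\sigma_3+\tfrac{2}{\zeta^3}Q-\tfrac{\rm i}{\zeta^2}Q^2\sigma_3+\tfrac1\zeta Q^3-\tfrac{\rm i}{\zeta}Q_x\sigma_3,\quad Q=\begin{pmatrix}0&u\\v&0\end{pmatrix},$$ $\sigma_1=\begin{pmatrix}0&1\\1&0\end{pmatrix}$, $\sigma_3=\begin{pmatrix}1&0\\0&-1\end{pmatrix}$. Let $\zeta_1,\dots,\zeta_n\in\mathbb C\setminus\{0\}$, let $m_1,\dots,m_n$ be the prescribed orders, and put $N=\sum_{i=1}^n m_i$. For each $i$ let $\Phi_i(\zeta)=(\varphi_i,\phi_i)^T(x,t;\zeta)$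 be a family of solutions of the Lax pair at the spectral parameters $\zeta$ in a neighbourhood of $\zeta_i$ (independent of $(x,t)\in W$), smooth in $(x,t,\zeta)$ and holomorphic in $\zeta$. In the order $D_1^{[0]},\dots,D_1^{[m_1-1]},D_2^{[0]},\dots,D_n^{[m_n-1]}$ define recursively, for $1\le i\le n$ and $0\le j<m_i$, $$ \Phi_i^{[j]}=\begin{pmatrix}\varphi_i^{[j]}\\ \phi_i^{[j]}\end{pmatrix}=\sum_{l=0}^{j}\frac{\Omega_{j-l}}{l!}\,\frac{{\rm d}^l\Phi_i}{{\rm d}\zeta^l}\Big|_{\zeta=\zeta_i},\qquad D_i^{[j]}=\begin{pmatrix}-\zeta_i\frac{\phi_i^{[j]}}{\varphi_i^{[j]}}&\zeta\\ \zeta&-\zeta_i\frac{\varphi_i^{[j]}}{\phi_i^{[j]}}\end{pmatrix}, $$ where $\Omega_l$ is the sum, over all choices of exponents $\delta_r^k\in\{0,1\}$ with total sum $l$, of the products $M_i^{[j-1]}\cdots M_i^{[0]}\cdots M_1^{[m_1-1]}\cdots M_1^{[0]}$, with $M_r^{[k]}=\sigma_1$ if $\delta_r^k=1$ and $M_r^{[k]}=D_r^{[k]}|_{\zeta=\zeta_i}$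 if $\delta_r^k=0$ (the empty product is the identity matrix, so $\Phi_1^{[0]}=\Phi_1(\zeta_1)$). Assume that all $\varphi_i^{[j]}$ and $\phi_i^{[j]}$ ($0\le j<m_i$) have no zeros in $W$, so that these factors are defined. Let $(u[s],v[s])$, $0\le s\le N$, be the fields after $s$ of the $N$ steps: $(u[0],v[0])=(u,v)$ and, for the step with factor $D_i^{[j]}$, $$u[s+1]=v[s]-\zeta_i\big(\phi_i^{[j]}/\varphi_i^{[j]}\big)_x,\qquad v[s+1]=u[s]-\zeta_i\big(\varphi_i^{[j]}/\phi_i^{[j]}\big)_x .$$ Then, on $W$: 1. *(New seeds.)* For all $i$ and $0\le j<m_i$, $$\Phi_i^{[j]}=\lim_{\epsilon\to0}\epsilon^{-j}\Big(\big[D_i^{[j-1]}\cdots D_i^{[0]}\cdots D_1^{[m_1-1]}\cdots D_1^{[0]}\big]\Phi_i\Big)\Big|_{\zeta=\zeta_i+\epsilon},$$ and $\Phi_i^{[j]}$ solves the Lax pair with fields $u[s],v[s]$, $s=m_1+\dots+m_{i-1}+j$, at $\zeta=\zeta_i$. 2. *($N$-fold gDT-I.)* The product of $N$ factors $$D_N=D_n^{[m_n-1]}\cdots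 D_n^{[0]}\cdots D_1^{[m_1-1]}\cdots D_1^{[0]}$$ satisfies $\det D_N(\zeta)=\prod_{i=1}^n(\zeta_i^2-\zeta^2)^{m_i}$, and $D_N(\zeta)\Phi_i(\zeta)$ has a zero of order at least $m_i$ at $\zeta=\zeta_i$. It is a Darboux matrix: $u[N],v[N]$ are smooth and solve the Kaup–Newell system; with $U[N],V[N]$ formed from $u[N],v[N]$ one has $D_{N,x}+D_NU=U[N]D_N$ and $D_{N,t}+D_NV=V[N]D_N$ for all $\zeta\neq0$; and if $\Phi$ solves the Lax pair of $(u,v)$ at some $\zeta\ne0$, then $D_N\Phi$ solves that of $(u[N],v[N])$ at $\zeta$. 3. *(Field formulas.)* Let $A$ be the $N\times N$ matrix with columns $\frac{1}{j!}\frac{{\rm d}^j}{{\rm d}\zeta^j}A_i^T\big|_{\zeta=\zeta_i}$ ($1\le i\le n$, $0\le j<m_i$), where $A_i(\zeta)$ is the row of length $N$ with entries $\zeta^k\varphi_i$ for even $k$ and $\zeta^k\phi_i$ for odd $k$, $k=0,1,\dots,N-1$; let $B$ be built in the same way from the rows $B_i(\zeta)$, which differ from $A_i(\zeta)$ in that the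 last exponent $k=N-1$ is replaced by $k=N$. Let $\widetilde A,\widetilde B$ be the matrices obtained from $A,B$ by interchanging $\varphi_j\leftrightarrow\phi_j$ for all $j$. Then $\det A$ and $\det\widetilde A$ have no zeros in $W$, the quotients below are differentiable in $x$, and $$u[N]=v-\Big[\frac{\det B}{\det A}\Big]_x,\quad v[N]=u-\Big[\frac{\det\widetilde B}{\det\widetilde A}\Big]_x\qquad(N\text{ odd}),$$ $$u[N]=u-\Big[\frac{\det B}{\det A}\Big]_x,\quad v[N]=v-\Big[\frac{\det\widetilde B}{\det\widetilde A}\Big]_x\qquad(N\text{ even}).$$ -/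

import Mathlib

open scoped Matrix ContDiff Topology

noncomputable section

namespace KaupNewell

/-! ### The Kaup-Newell system and its Lax pair

Fields `u v : ℝ → ℝ → ℂ` are functions of `(x, t)`, in this order. -/

/-- The `x`-derivative of a function of `(x, t)`. -/
def dX (f : ℝ → ℝ → ℂ) (x t : ℝ) : ℂ := deriv (fun y : ℝ => f y t) x

/-- The `t`-derivative of a function of `(x, t)`. -/
def dT (f : ℝ → ℝ → ℂ) (x t : ℝ) : ℂ := deriv (fun s : ℝ => f x s) t

/-- `f` is smooth on the region `W` of the `(x, t)`-plane. -/
def SmoothField (W : Set (ℝ × ℝ)) (f : ℝ → ℝ → ℂ) : Prop :=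
  ContDiffOn ℝ ∞ (fun p : ℝ × ℝ => f p.1 p.2) W

/-- `(u, v)` satisfies, on `W`,
`i u_t + u_xx - i (u² v)_x = 0` and `-i v_t + v_xx + i (u v²)_x = 0`. -/
def IsKNSol (W : Set (ℝ × ℝ)) (u v : ℝ → ℝ → ℂ) : Prop :=
  ∀ x t : ℝ, (x, t) ∈ W →
    Complex.I * dT u x t + dX (dX u) x t
        - Complex.I * dX (fun y s => u y s ^ 2 * v y s) x t = 0 ∧
    -Complex.I * dT v x t + dX (dX v) x t
        + Complex.I * dX (fun y s => u y s * v y s ^ 2) x t = 0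

def sigma1 : Matrix (Fin 2) (Fin 2) ℂ := !![0, 1; 1, 0]

def sigma3 : Matrix (Fin 2) (Fin 2) ℂ := !![1, 0; 0, -1]

/-- `Q = (0, u; v, 0)`. -/
def potQ (u v : ℂ) : Matrix (Fin 2) (Fin 2) ℂ := !![0, u; v, 0]

/-- `U = -(i/z²) σ₃ + (1/z) Q`. -/
def laxU (u v : ℝ → ℝ → ℂ) (z : ℂ) (x t : ℝ) : Matrix (Fin 2) (Fin 2) ℂ :=
  -(Complex.I / z ^ 2) • sigma3 + (1 / z) • potQ (u x t) (v x t)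

/-- `V = -(2i/z⁴) σ₃ + (2/z³) Q - (i/z²) Q² σ₃ + (1/z) Q³ - (i/z) Q_x σ₃`. -/
def laxV (u v : ℝ → ℝ → ℂ) (z : ℂ) (x t : ℝ) : Matrix (Fin 2) (Fin 2) ℂ :=
  -(2 * Complex.I / z ^ 4) • sigma3 + (2 / z ^ 3) • potQ (u x t) (v x t)
    - (Complex.I / z ^ 2) • (potQ (u x t) (v x t) ^ 2 * sigma3)
    + (1 / z) • potQ (u x t) (v x t) ^ 3
    - (Complex.I / z) • (potQ (dX u x t) (dX v x t) * sigma3)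

/-- `Ψ` solves the Lax pair `Ψ_x = U Ψ`, `Ψ_t = V Ψ` on `W` at the spectral parameter `z`. -/
def IsLaxSol (W : Set (ℝ × ℝ)) (u v : ℝ → ℝ → ℂ) (z : ℂ) (Ψ : ℝ → ℝ → Fin 2 → ℂ) : Prop :=
  ∀ x t : ℝ, (x, t) ∈ W →
    HasDerivAt (fun y : ℝ => Ψ y t) (laxU u v z x t *ᵥ Ψ x t) x ∧
    HasDerivAt (fun s : ℝ => Ψ x s) (laxV u v z x t *ᵥ Ψ x t) t

/-- A seed at the spectral parameter `w`: a family `f z = (φ(z), ϕ(z))ᵀ` of solutions of the Lax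
pair at the spectral parameters `z` near `w`, smooth in `(z, x, t)` and holomorphic in `z`.
Component `0` is `φ` (first entry of the column), component `1` is `ϕ`. -/
def IsSeed (W : Set (ℝ × ℝ)) (u v : ℝ → ℝ → ℂ) (w : ℂ) (f : ℂ → ℝ → ℝ → Fin 2 → ℂ) : Prop :=
  ∃ O : Set ℂ, IsOpen O ∧ w ∈ O ∧ (0 : ℂ) ∉ O ∧
    ContDiffOn ℝ ∞ (fun p : ℂ × (ℝ × ℝ) => f p.1 p.2.1 p.2.2) (O ×ˢ W) ∧
    (∀ x t : ℝ, (x, t) ∈ W → DifferentiableOn ℂ (fun z => f z x t) O) ∧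
    ∀ z ∈ O, IsLaxSol W u v z (f z)

/-! ### Chains of elementary Darboux transformations -/

/-- The elementary Darboux matrix `(-w ϕ/φ, z; z, -w φ/ϕ)` with zero `w` and vector
`p = (φ, ϕ)`, at the spectral parameter `z`. -/
def eDT (w : ℂ) (p : Fin 2 → ℂ) (z : ℂ) : Matrix (Fin 2) (Fin 2) ℂ :=
  !![-w * (p 1 / p 0), z; z, -w * (p 0 / p 1)]

/-- A finite sequence of elementary Darboux transformations, each given by its spectral parameter
and its vector function of `(x, t)`. The head of the list is the one that is applied last. -/
abbrev Chain := List (ℂ × (ℝ → ℝ → Fin 2 → ℂ))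

/-- The product of the Darboux matrices of a chain, the last applied one on the left. -/
def dtProd (L : Chain) (z : ℂ) (x t : ℝ) : Matrix (Fin 2) (Fin 2) ℂ :=
  (L.map fun e => eDT e.1 (e.2 x t) z).prod

/-- The fields produced by a chain from `(u, v)`. One step with `(w, p)` replaces `Q` by
`σ₁ Q σ₁ - 2 w σ₁ P_x σ₁` with `P = p pᵀ σ₁ / (pᵀ σ₁ p)`; the off-diagonal entries of `2 P` are
`φ/ϕ` (upper) and `ϕ/φ` (lower), its diagonal entries are `1`. -/
def dtFields (u v : ℝ → ℝ → ℂ) : Chain → (ℝ → ℝ → ℂ) × (ℝ → ℝ → ℂ)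
  | [] => (u, v)
  | e :: L =>
      (fun x t => (dtFields u v L).2 x t - e.1 * dX (fun y s => e.2 y s 1 / e.2 y s 0) x t,
       fun x t => (dtFields u v L).1 x t - e.1 * dX (fun y s => e.2 y s 0 / e.2 y s 1) x t)

/-- `Ω_l` at `z`: the sum, over all `δ ∈ {0, 1}^L` of weight `l`, of the products of the matrices
`σ₁` (at positions with `δ = 1`) and of the Darboux matrices of the chain at the spectral
parameter `z` (at positions with `δ = 0`). -/
def omega (L : Chain) (l : ℕ) (z : ℂ) (x t : ℝ) : Matrix (Fin 2) (Fin 2) ℂ :=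
  ∑ δ : Fin L.length → Fin 2 with ∑ k, (δ k : ℕ) = l,
    (List.ofFn fun k : Fin L.length =>
      if δ k = 1 then sigma1 else eDT (L.get k).1 ((L.get k).2 x t) z).prod

/-- `∑_{l=0}^{j} (Ω_{j-l} / l!) (d^l f / dz^l)(w)`, with `Ω` formed from the chain `L` at `w`. -/
def nextVector (L : Chain) (w : ℂ) (f : ℂ → ℝ → ℝ → Fin 2 → ℂ) (j : ℕ) (x t : ℝ) : Fin 2 → ℂ :=
  ∑ l ∈ Finset.range (j + 1),
    ((l.factorial : ℂ)⁻¹) • (omega L (j - l) w x t *ᵥ iteratedDeriv l (fun z => f z x t) w)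

/-- The chain `L`, followed by `j` elementary Darboux transformations at the same spectral
parameter `w`, whose vectors are built from the seed `f`. -/
def extendChain (L : Chain) (w : ℂ) (f : ℂ → ℝ → ℝ → Fin 2 → ℂ) : ℕ → Chain
  | 0 => L
  | j + 1 => (w, nextVector (extendChain L w f j) w f j) :: extendChain L w f j

/-- The chain of the factors `D_k^{[j]}`, `k < i`, `j < m k`, in lexicographic order of `(k, j)`. -/
def gdtChain (m : ℕ → ℕ) (ζ : ℕ → ℂ) (Φ : ℕ → ℂ → ℝ → ℝ → Fin 2 → ℂ) : ℕ → Chain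
  | 0 => []
  | i + 1 => extendChain (gdtChain m ζ Φ i) (ζ i) (Φ i) (m i)

/-- The chain of all the factors that precede `D_i^{[j]}`. -/
def gdtBefore (m : ℕ → ℕ) (ζ : ℕ → ℂ) (Φ : ℕ → ℂ → ℝ → ℝ → Fin 2 → ℂ) (i j : ℕ) : Chain :=
  extendChain (gdtChain m ζ Φ i) (ζ i) (Φ i) j

/-- The vector `Φ_i^{[j]} = (φ_i^{[j]}, ϕ_i^{[j]})ᵀ` of the factor `D_i^{[j]}`. -/
def gdtVector (m : ℕ → ℕ) (ζ : ℕ → ℂ) (Φ : ℕ → ℂ → ℝ → ℝ → Fin 2 → ℂ) (i j : ℕ) :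
    ℝ → ℝ → Fin 2 → ℂ :=
  nextVector (gdtBefore m ζ Φ i j) (ζ i) (Φ i) j

/-! ### The determinants -/

/-- The `N × N` matrix, `N = ∑ m_i`, whose columns, ordered lexicographically by `(i, j)`, are
`(1/j!) d^j/dz^j` at `z = ζ_i` of the vector with entries `z^(e k) φ_i(z)` for `e k` even and
`z^(e k) ϕ_i(z)` for `e k` odd. Here `f i z = (φ_i(z), ϕ_i(z))`. -/
def confluentMatrix (n : ℕ) (m : ℕ → ℕ) (ζ : ℕ → ℂ) (f : ℕ → ℂ → Fin 2 → ℂ) (e : ℕ → ℕ) :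
    Matrix (Fin (∑ i : Fin n, m i)) (Fin (∑ i : Fin n, m i)) ℂ :=
  Matrix.of fun k c =>
    let s : (i : Fin n) × Fin (m i) := finSigmaFinEquiv.symm c
    iteratedDeriv (s.2 : ℕ)
        (fun z => z ^ e k * (if Even (e k) then f (s.1 : ℕ) z 0 else f (s.1 : ℕ) z 1)) (ζ s.1)
      / ((s.2 : ℕ).factorial : ℂ)

/-- Denominator determinant: the exponents are `0, 1, …, N - 1`. -/
def detDen (n : ℕ) (m : ℕ → ℕ) (ζ : ℕ → ℂ) (f : ℕ → ℂ → Fin 2 → ℂ) : ℂ :=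
  (confluentMatrix n m ζ f fun k => k).det

/-- Numerator determinant: the exponents are `0, 1, …, N - 2, N`. -/
def detNum (n : ℕ) (m : ℕ → ℕ) (ζ : ℕ → ℂ) (f : ℕ → ℂ → Fin 2 → ℂ) : ℂ :=
  (confluentMatrix n m ζ f fun k => if k + 1 = ∑ i : Fin n, m i then k + 1 else k).det

/-- The seeds at `(x, t)`, as functions of the index and the spectral parameter. -/
def seedsAt (Φ : ℕ → ℂ → ℝ → ℝ → Fin 2 → ℂ) (x t : ℝ) : ℕ → ℂ → Fin 2 → ℂ :=
  fun i z => Φ i z x t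

/-- The seeds at `(x, t)` with `φ_i` and `ϕ_i` interchanged for all `i`. -/
def swappedAt (Φ : ℕ → ℂ → ℝ → ℝ → Fin 2 → ℂ) (x t : ℝ) : ℕ → ℂ → Fin 2 → ℂ :=
  fun i z => ![Φ i z x t 1, Φ i z x t 0]

/-- The ratio of determinants as a function of `(x, t)`. -/
def ratio (n : ℕ) (m : ℕ → ℕ) (ζ : ℕ → ℂ) (Φ : ℕ → ℂ → ℝ → ℝ → Fin 2 → ℂ) (x t : ℝ) : ℂ :=
  detNum n m ζ (seedsAt Φ x t) / detDen n m ζ (seedsAt Φ x t)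

/-- The ratio of determinants with `φ_i` and `ϕ_i` interchanged, as a function of `(x, t)`. -/
def ratioSwapped (n : ℕ) (m : ℕ → ℕ) (ζ : ℕ → ℂ) (Φ : ℕ → ℂ → ℝ → ℝ → Fin 2 → ℂ)
    (x t : ℝ) : ℂ :=
  detNum n m ζ (swappedAt Φ x t) / detDen n m ζ (swappedAt Φ x t)

end KaupNewell

end

open KaupNewell

noncomputable section

namespace KaupNewell

section

/-! ### Calculus of smooth fields -/

variable {W : Set (ℝ × ℝ)} {u v f g : ℝ → ℝ → ℂ} {x t : ℝ}

/-! One step. If `p` solves the Lax pair at `w`, the ratio `r = p 1 / p 0` satisfies Riccati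
equations in `x` and `t`. They eliminate the derivative from the new fields, which become rational
in `r` and the old fields: `u' = -2i r/w + u r²`, and likewise `v'` in `1/r`. The Kaup–Newell
equations for `(u', v')` and the intertwining property of the Darboux matrix then reduce to rational
identities with `i² = -1` (`kaupNewell_identity`, `IsStep.intertwines`). Both properties pass to
chains by composition.

Confluent seeds. Since `eDT e p z = eDT e p w + (z - w) σ₁`, the sums `Ω_l` are the Taylor
coefficients of a product at `w`, so `Φ_i^{[j]}` is the `j`-th Taylor coefficient of `D Φ_i` at
`ζ_i`, with `D` the product of the earlier factors (`nextVector_apply`). The lower coefficients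
vanish, hence taking the `j`-th coefficient of the Lax equations for `D Φ_i` leaves the Lax
equations at `ζ_i` (`IsSeed.isLaxSol_dtTaylor`). The next factor kills this coefficient and raises
the order of the zero by one (`dtTaylor_extendChain_eq_zero`).

Determinants. Each row of a product of `s` factors is a polynomial in `z` with leading coefficient
`1`, the parity of the exponent selecting the component it multiplies. The prescribed zeros are
linear relations between the rows of the confluent matrices. Partial products triangularize `A` with
components of `Φ_i^{[j]}` on the diagonal, so `det A ≠ 0`; the full product expresses the row of
exponent `N` by the others, so `det B / det A` is minus the coefficient of `z ^ (N - 1)`. That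
coefficient is a sum of diagonal entries of the factors, whose `x`-derivatives are the increments of
the fields (`IsDarbouxChain.dtFields_eq`). -/

theorem SmoothField.contDiffAt (hW : IsOpen W) (hf : SmoothField W f) (h : (x, t) ∈ W) :
    ContDiffAt ℝ ∞ (fun p : ℝ × ℝ => f p.1 p.2) (x, t) :=
  ContDiffOn.contDiffAt hf (hW.mem_nhds h)

theorem SmoothField.hasDerivAt_fderiv_x (hW : IsOpen W) (hf : SmoothField W f)
    (h : (x, t) ∈ W) :
    HasDerivAt (fun y => f y t) (fderiv ℝ (fun p : ℝ × ℝ => f p.1 p.2) (x, t) (1, 0)) x := by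
  have h1 := ((hf.contDiffAt hW h).differentiableAt (by simp)).hasFDerivAt
  exact h1.comp_hasDerivAt x ((hasDerivAt_id x).prodMk (hasDerivAt_const x t))

theorem SmoothField.hasDerivAt_fderiv_t (hW : IsOpen W) (hf : SmoothField W f)
    (h : (x, t) ∈ W) :
    HasDerivAt (fun s => f x s) (fderiv ℝ (fun p : ℝ × ℝ => f p.1 p.2) (x, t) (0, 1)) t := by
  have h1 := ((hf.contDiffAt hW h).differentiableAt (by simp)).hasFDerivAt
  exact h1.comp_hasDerivAt t ((hasDerivAt_const t x).prodMk (hasDerivAt_id t))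

theorem SmoothField.hasDerivAt_dX (hW : IsOpen W) (hf : SmoothField W f) (h : (x, t) ∈ W) :
    HasDerivAt (fun y => f y t) (dX f x t) x :=
  (hf.hasDerivAt_fderiv_x hW h).differentiableAt.hasDerivAt

theorem SmoothField.hasDerivAt_dT (hW : IsOpen W) (hf : SmoothField W f) (h : (x, t) ∈ W) :
    HasDerivAt (fun s => f x s) (dT f x t) t :=
  (hf.hasDerivAt_fderiv_t hW h).differentiableAt.hasDerivAt

theorem SmoothField.congr (hf : SmoothField W f) (h : ∀ x t, (x, t) ∈ W → g x t = f x t) :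
    SmoothField W g :=
  ContDiffOn.congr hf fun p hp => h p.1 p.2 hp

theorem SmoothField.dX (hW : IsOpen W) (hf : SmoothField W f) : SmoothField W (dX f) := by
  have h1 : ContDiffOn ℝ ∞ (fun p => fderiv ℝ (fun p : ℝ × ℝ => f p.1 p.2) p ((1, 0) : ℝ × ℝ)) W :=
    (ContDiffOn.fderiv_of_isOpen hf hW (by simp)).clm_apply contDiffOn_const
  exact h1.congr fun p hp => (hf.hasDerivAt_fderiv_x hW (x := p.1) (t := p.2) hp).deriv

theorem eventually_mem_x (hW : IsOpen W) (h : (x, t) ∈ W) : ∀ᶠ y in 𝓝 x, (y, t) ∈ W :=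
  (Continuous.prodMk_left t).continuousAt.eventually (hW.mem_nhds h)

theorem eventually_mem_t (hW : IsOpen W) (h : (x, t) ∈ W) : ∀ᶠ s in 𝓝 t, (x, s) ∈ W :=
  (Continuous.prodMk_right x).continuousAt.eventually (hW.mem_nhds h)

theorem eventuallyEq_x (hW : IsOpen W) (h : (x, t) ∈ W) (hfg : ∀ x t, (x, t) ∈ W → f x t = g x t) :
    (fun y => f y t) =ᶠ[𝓝 x] fun y => g y t :=
  (eventually_mem_x hW h).mono fun y hy => hfg y t hy

theorem eventuallyEq_t (hW : IsOpen W) (h : (x, t) ∈ W) (hfg : ∀ x t, (x, t) ∈ W → f x t = g x t) :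
    (fun s => f x s) =ᶠ[𝓝 t] fun s => g x s :=
  (eventually_mem_t hW h).mono fun s hs => hfg x s hs

theorem dX_congr (hW : IsOpen W) (h : (x, t) ∈ W) (hfg : ∀ x t, (x, t) ∈ W → f x t = g x t) :
    dX f x t = dX g x t := (eventuallyEq_x hW h hfg).deriv_eq

/-! ### The elementary Darboux transformation -/

/-- All derivatives are independent letters, tied only by the seed equation and the Riccati
equations. Keeping `i` as a root of `i² = -1` lets `-i` be substituted later. -/
theorem kaupNewell_identity (i u v ux vx uxx r w ut rt rx rxx u' v' u'x v'x : ℂ)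
    (hi : i ^ 2 = -1) (hw : w ≠ 0) (hr : r ≠ 0)
    (hut : ut = i * uxx + (2 * u * ux * v + u ^ 2 * vx))
    (hrt : rt = (2 * v / w ^ 3 + u * v ^ 2 / w - i * vx / w)
      + 2 * (2 * i / w ^ 4 + i * u * v / w ^ 2) * r
      - (2 * u / w ^ 3 + u ^ 2 * v / w + i * ux / w) * r ^ 2)
    (hrx : rx = v / w + 2 * i / w ^ 2 * r - u / w * r ^ 2)
    (hrxx : rxx = vx / w + 2 * i / w ^ 2 * rx - ux / w * r ^ 2 - 2 * u / w * r * rx)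
    (hu' : u' = -2 * i / w * r + u * r ^ 2) (hv' : v' = v / r ^ 2 + 2 * i / (w * r))
    (hu'x : u'x = -2 * i / w * rx + ux * r ^ 2 + 2 * u * r * rx)
    (hv'x : v'x = vx / r ^ 2 - 2 * v * rx / r ^ 3 - 2 * i * rx / (w * r ^ 2)) :
    i * (-2 * i / w * rt + ut * r ^ 2 + 2 * u * r * rt)
      + (-2 * i / w * rxx + uxx * r ^ 2 + 4 * ux * r * rx + 2 * u * rx ^ 2 + 2 * u * r * rxx)
      - i * (2 * u' * u'x * v' + u' ^ 2 * v'x) = 0 := by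
  have hi3 : i ^ 3 = -i := by rw [pow_succ, hi]; ring
  have hi4 : i ^ 4 = 1 := by rw [pow_succ, hi3]; linear_combination -hi
  have hi5 : i ^ 5 = i := by rw [pow_succ, hi4]; ring
  subst hu' hv' hu'x hv'x hut hrt hrxx hrx
  field_simp
  ring_nf
  simp only [hi, hi3, hi4, hi5]
  ring

/-- The Riccati equations satisfied by the ratio of the components of a solution of the Lax pair
at `w`. The equations for the reciprocal have `u`, `v` interchanged and `-i` in place of `i`. -/
def IsRiccati (W : Set (ℝ × ℝ)) (i : ℂ) (u v : ℝ → ℝ → ℂ) (w : ℂ) (r : ℝ → ℝ → ℂ) : Prop :=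
  ∀ x t : ℝ, (x, t) ∈ W →
    HasDerivAt (fun y => r y t)
      (v x t / w + 2 * i / w ^ 2 * r x t - u x t / w * r x t ^ 2) x ∧
    HasDerivAt (fun s => r x s)
      ((2 * v x t / w ^ 3 + u x t * v x t ^ 2 / w - i * dX v x t / w)
        + 2 * (2 * i / w ^ 4 + i * u x t * v x t / w ^ 2) * r x t
        - (2 * u x t / w ^ 3 + u x t ^ 2 * v x t / w + i * dX u x t / w) * r x t ^ 2) t

/-- Stated for the first equation only: the second is the first with `u`, `v` interchanged and `i`
replaced by `-i`. -/
theorem IsRiccati.kaupNewell (hW : IsOpen W) {i w : ℂ} (hi : i ^ 2 = -1) (hw : w ≠ 0)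
    (hu : SmoothField W u) (hv : SmoothField W v)
    (hKN : ∀ x t : ℝ, (x, t) ∈ W → i * dT u x t + dX (dX u) x t
      - i * dX (fun y s => u y s ^ 2 * v y s) x t = 0)
    {r s u' v' : ℝ → ℝ → ℂ} (hr : IsRiccati W i u v w r)
    (hr0 : ∀ x t, (x, t) ∈ W → r x t ≠ 0) (hs : ∀ x t, (x, t) ∈ W → s x t = (r x t)⁻¹)
    (hu' : ∀ x t, (x, t) ∈ W → u' x t = v x t - w * dX r x t)
    (hv' : ∀ x t, (x, t) ∈ W → v' x t = u x t - w * dX s x t) :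
    ∀ x t : ℝ, (x, t) ∈ W → i * dT u' x t + dX (dX u') x t
      - i * dX (fun y s => u' y s ^ 2 * v' y s) x t = 0 := by
  set rx : ℝ → ℝ → ℂ := fun x t => v x t / w + 2 * i / w ^ 2 * r x t - u x t / w * r x t ^ 2
    with hrx
  have drx : ∀ {x t}, (x, t) ∈ W → HasDerivAt (fun y => r y t) (rx x t) x :=
    fun {x t} h => (hr x t h).1
  -- The Riccati equation removes the derivative of `r`, so differentiating `u'` never needs a
  -- higher derivative of `r` than the equation does.
  have eu' : ∀ x t, (x, t) ∈ W → u' x t = -2 * i / w * r x t + u x t * r x t ^ 2 := by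
    intro x t h
    rw [hu' x t h, show dX r x t = rx x t from (drx h).deriv, hrx]
    field_simp; ring
  have ev' : ∀ x t, (x, t) ∈ W → v' x t = v x t / r x t ^ 2 + 2 * i / (w * r x t) := by
    intro x t h
    have h0 := hr0 x t h
    rw [hv' x t h, dX_congr hW h hs,
      show dX (fun x t => (r x t)⁻¹) x t = -rx x t / r x t ^ 2 from ((drx h).inv h0).deriv, hrx]
    field_simp; ring
  have du' : ∀ x t, (x, t) ∈ W → HasDerivAt (fun y => u' y t)
      (-2 * i / w * rx x t + dX u x t * r x t ^ 2 + 2 * u x t * r x t * rx x t) x := by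
    intro x t h
    have h1 := ((drx h).const_mul (-2 * i / w)).add
      ((hu.hasDerivAt_dX hW h).mul ((drx h).pow 2))
    refine (h1.congr_of_eventuallyEq (eventuallyEq_x hW h eu')).congr_deriv ?_
    simp; ring
  intro x t h
  have h0 := hr0 x t h
  have dut : HasDerivAt (fun s => u' x s) (-2 * i / w * dT r x t + dT u x t * r x t ^ 2
      + 2 * u x t * r x t * dT r x t) t := by
    have h2 := (hr x t h).2.differentiableAt.hasDerivAt
    have h1 := (h2.const_mul (-2 * i / w)).add ((hu.hasDerivAt_dT hW h).mul (h2.pow 2))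
    refine (h1.congr_of_eventuallyEq (eventuallyEq_t hW h eu')).congr_deriv ?_
    simp only [dT]; simp; ring
  have drxx : HasDerivAt (fun y => rx y t) (dX v x t / w + 2 * i / w ^ 2 * rx x t
      - dX u x t / w * r x t ^ 2 - 2 * u x t / w * r x t * rx x t) x := by
    have h1 := (((hv.hasDerivAt_dX hW h).div_const w).add
      ((drx h).const_mul (2 * i / w ^ 2))).sub
      (((hu.hasDerivAt_dX hW h).div_const w).mul ((drx h).pow 2))
    refine h1.congr_deriv ?_
    simp; ring
  set rxx := dX v x t / w + 2 * i / w ^ 2 * rx x t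
      - dX u x t / w * r x t ^ 2 - 2 * u x t / w * r x t * rx x t with hrxx
  have duxx : HasDerivAt (fun y => dX u' y t) (-2 * i / w * rxx + dX (dX u) x t * r x t ^ 2
      + 4 * dX u x t * r x t * rx x t + 2 * u x t * rx x t ^ 2 + 2 * u x t * r x t * rxx) x := by
    have h1 := ((drxx.const_mul (-2 * i / w)).add
      (((hu.dX hW).hasDerivAt_dX hW h).mul ((drx h).pow 2))).add
      ((((hu.hasDerivAt_dX hW h).const_mul 2).mul (drx h)).mul drxx)
    refine (h1.congr_of_eventuallyEq
      (eventuallyEq_x hW h fun x t h => (du' x t h).deriv)).congr_deriv ?_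
    simp; ring
  have dv' : HasDerivAt (fun y => v' y t) (dX v x t / r x t ^ 2
      - 2 * v x t * rx x t / r x t ^ 3 - 2 * i * rx x t / (w * r x t ^ 2)) x := by
    have h1 := ((hv.hasDerivAt_dX hW h).div ((drx h).pow 2) (pow_ne_zero 2 h0)).add
      ((hasDerivAt_const x (2 * i)).div ((drx h).const_mul w) (mul_ne_zero hw h0))
    refine (h1.congr_of_eventuallyEq (eventuallyEq_x hW h ev')).congr_deriv ?_
    simp; field_simp; ring
  have dq : HasDerivAt (fun y => u' y t ^ 2 * v' y t) _ x := ((du' x t h).pow 2).mul dv'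
  have dp : HasDerivAt (fun y => u y t ^ 2 * v y t) _ x :=
    ((hu.hasDerivAt_dX hW h).pow 2).mul (hv.hasDerivAt_dX hW h)
  have hk := hKN x t h
  rw [show dX (fun y s => u y s ^ 2 * v y s) x t
    = 2 * u x t * dX u x t * v x t + u x t ^ 2 * dX v x t from dp.deriv.trans (by simp)] at hk
  rw [show dT u' x t = _ from dut.deriv, show dX (dX u') x t = _ from duxx.deriv,
    show dX (fun y s => u' y s ^ 2 * v' y s) x t = _ from dq.deriv]
  have key := kaupNewell_identity i (u x t) (v x t) (dX u x t) (dX v x t) (dX (dX u) x t)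
    (r x t) w (dT u x t) (dT r x t) (rx x t) rxx _ _ _ _ hi hw h0
    (by linear_combination (-i) * hk
      + (dT u x t - (2 * u x t * dX u x t * v x t + u x t ^ 2 * dX v x t)) * hi)
    (hr x t h).2.deriv rfl hrxx (eu' x t h) (ev' x t h) rfl rfl
  convert key using 2
  simp

end

/-! ### Intertwining of Lax pairs and the single Darboux step -/

section

variable {W : Set (ℝ × ℝ)} {u v u' v' : ℝ → ℝ → ℂ} {x t : ℝ}

theorem laxU_eq (u v : ℝ → ℝ → ℂ) (z : ℂ) (x t : ℝ) :
    laxU u v z x t = !![-Complex.I / z ^ 2, u x t / z; v x t / z, Complex.I / z ^ 2] := by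
  ext a b
  fin_cases a <;> fin_cases b <;> simp [laxU, sigma3, potQ] <;> ring

theorem laxV_eq (u v : ℝ → ℝ → ℂ) (z : ℂ) (x t : ℝ) :
    laxV u v z x t =
      !![-(2 * Complex.I / z ^ 4 + Complex.I * u x t * v x t / z ^ 2),
        2 * u x t / z ^ 3 + u x t ^ 2 * v x t / z + Complex.I * dX u x t / z;
        2 * v x t / z ^ 3 + u x t * v x t ^ 2 / z - Complex.I * dX v x t / z,
        2 * Complex.I / z ^ 4 + Complex.I * u x t * v x t / z ^ 2] := by
  ext a b
  fin_cases a <;> fin_cases b <;>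
    simp [laxV, sigma3, potQ, pow_succ] <;> ring

/-- `M` intertwines the Lax pairs of `(u, v)` and `(u', v')` at the spectral parameter `z`. -/
def Intertwines (W : Set (ℝ × ℝ)) (u v u' v' : ℝ → ℝ → ℂ) (z : ℂ)
    (M : ℝ → ℝ → Matrix (Fin 2) (Fin 2) ℂ) : Prop :=
  ∀ x t : ℝ, (x, t) ∈ W → ∀ a b : Fin 2,
    HasDerivAt (fun y : ℝ => M y t a b)
      ((laxU u' v' z x t * M x t - M x t * laxU u v z x t) a b) x ∧
    HasDerivAt (fun s : ℝ => M x s a b)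
      ((laxV u' v' z x t * M x t - M x t * laxV u v z x t) a b) t

theorem Intertwines.one (z : ℂ) : Intertwines W u v u v z fun _ _ => 1 := by
  intro x t _ a b
  simpa using ⟨hasDerivAt_const x _, hasDerivAt_const t _⟩

theorem hasDerivAt_matrix_mul {M N : ℝ → Matrix (Fin 2) (Fin 2) ℂ}
    {M' N' : Matrix (Fin 2) (Fin 2) ℂ} {y : ℝ}
    (hM : ∀ a b, HasDerivAt (fun y => M y a b) (M' a b) y)
    (hN : ∀ a b, HasDerivAt (fun y => N y a b) (N' a b) y) (a b : Fin 2) :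
    HasDerivAt (fun y => (M y * N y) a b) ((M' * N y + M y * N') a b) y := by
  simp only [Matrix.mul_apply, Matrix.add_apply, Fin.sum_univ_two]
  refine (((hM a 0).mul (hN 0 b)).add ((hM a 1).mul (hN 1 b))).congr_deriv ?_
  ring

theorem hasDerivAt_mulVec {M : ℝ → Matrix (Fin 2) (Fin 2) ℂ} {Ψ : ℝ → Fin 2 → ℂ}
    {M' : Matrix (Fin 2) (Fin 2) ℂ} {Ψ' : Fin 2 → ℂ} {y : ℝ}
    (hM : ∀ a b, HasDerivAt (fun y => M y a b) (M' a b) y) (hΨ : HasDerivAt Ψ Ψ' y) :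
    HasDerivAt (fun y => M y *ᵥ Ψ y) (M' *ᵥ Ψ y + M y *ᵥ Ψ') y := by
  rw [hasDerivAt_pi] at hΨ ⊢
  intro a
  simp only [Matrix.mulVec, dotProduct, Pi.add_apply, Fin.sum_univ_two]
  refine (((hM a 0).mul (hΨ 0)).add ((hM a 1).mul (hΨ 1))).congr_deriv ?_
  ring

/-- In `(U''M - MU')N + M(U'N - NU)` the middle terms cancel; the same holds for `V`. -/
theorem Intertwines.mul {u'' v'' : ℝ → ℝ → ℂ} {z : ℂ} {M N : ℝ → ℝ → Matrix (Fin 2) (Fin 2) ℂ}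
    (hM : Intertwines W u' v' u'' v'' z M) (hN : Intertwines W u v u' v' z N) :
    Intertwines W u v u'' v'' z fun x t => M x t * N x t := by
  intro x t h a b
  constructor
  · refine (hasDerivAt_matrix_mul (fun a b => (hM x t h a b).1)
      (fun a b => (hN x t h a b).1) a b).congr_deriv ?_
    refine congrFun (congrFun ?_ a) b
    simp only [Matrix.sub_mul, Matrix.mul_sub, Matrix.mul_assoc]
    abel
  · refine (hasDerivAt_matrix_mul (fun a b => (hM x t h a b).2)
      (fun a b => (hN x t h a b).2) a b).congr_deriv ?_
    refine congrFun (congrFun ?_ a) b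
    simp only [Matrix.sub_mul, Matrix.mul_sub, Matrix.mul_assoc]
    abel

theorem Intertwines.isLaxSol {z : ℂ} {M : ℝ → ℝ → Matrix (Fin 2) (Fin 2) ℂ}
    (hM : Intertwines W u v u' v' z M) {Ψ : ℝ → ℝ → Fin 2 → ℂ} (hΨ : IsLaxSol W u v z Ψ) :
    IsLaxSol W u' v' z fun x t => M x t *ᵥ Ψ x t := by
  intro x t h
  constructor
  · refine (hasDerivAt_mulVec (fun a b => (hM x t h a b).1) (hΨ x t h).1).congr_deriv ?_
    rw [Matrix.sub_mulVec, Matrix.mulVec_mulVec, Matrix.mulVec_mulVec, sub_add_cancel]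
  · refine (hasDerivAt_mulVec (fun a b => (hM x t h a b).2) (hΨ x t h).2).congr_deriv ?_
    rw [Matrix.sub_mulVec, Matrix.mulVec_mulVec, Matrix.mulVec_mulVec, sub_add_cancel]

theorem IsLaxSol.isRiccati {w : ℂ} (hw : w ≠ 0) {p : ℝ → ℝ → Fin 2 → ℂ}
    (hp : IsLaxSol W u v w p) (h0 : ∀ x t, (x, t) ∈ W → p x t 0 ≠ 0) :
    IsRiccati W Complex.I u v w fun x t => p x t 1 / p x t 0 := by
  intro x t h
  have h00 := h0 x t h
  obtain ⟨hx, ht⟩ := hp x t h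
  rw [hasDerivAt_pi] at hx ht
  constructor
  · refine ((hx 1).div (hx 0) h00).congr_deriv ?_
    rw [laxU_eq]
    simp [Matrix.mulVec, dotProduct, Fin.sum_univ_two]
    field_simp
    ring
  · refine ((ht 1).div (ht 0) h00).congr_deriv ?_
    rw [laxV_eq]
    simp [Matrix.mulVec, dotProduct, Fin.sum_univ_two]
    field_simp
    ring

theorem IsLaxSol.isRiccati_swap {w : ℂ} (hw : w ≠ 0) {p : ℝ → ℝ → Fin 2 → ℂ}
    (hp : IsLaxSol W u v w p) (h0 : ∀ x t, (x, t) ∈ W → p x t 1 ≠ 0) :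
    IsRiccati W (-Complex.I) v u w fun x t => p x t 0 / p x t 1 := by
  intro x t h
  have h00 := h0 x t h
  obtain ⟨hx, ht⟩ := hp x t h
  rw [hasDerivAt_pi] at hx ht
  constructor
  · refine ((hx 0).div (hx 1) h00).congr_deriv ?_
    rw [laxU_eq]
    simp [Matrix.mulVec, dotProduct, Fin.sum_univ_two]
    field_simp
    ring
  · refine ((ht 0).div (ht 1) h00).congr_deriv ?_
    rw [laxV_eq]
    simp [Matrix.mulVec, dotProduct, Fin.sum_univ_two]
    field_simp
    ring

/-- The data of a step: a smooth solution of the Lax pair without zeros. -/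
structure IsStep (W : Set (ℝ × ℝ)) (u v : ℝ → ℝ → ℂ) (w : ℂ) (p : ℝ → ℝ → Fin 2 → ℂ) : Prop where
  ne_zero : w ≠ 0
  smooth : ∀ a, SmoothField W fun x t => p x t a
  apply_ne_zero : ∀ a x t, (x, t) ∈ W → p x t a ≠ 0
  isLaxSol : IsLaxSol W u v w p

namespace IsStep

variable {w : ℂ} {p : ℝ → ℝ → Fin 2 → ℂ}

theorem smooth_ratio (h : IsStep W u v w p) (a b : Fin 2) :
    SmoothField W fun x t => p x t a / p x t b := by
  have h1 : SmoothField W fun x t => p x t a * (p x t b)⁻¹ :=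
    ContDiffOn.mul (h.smooth a)
      (ContDiffOn.inv (h.smooth b) fun q hq => h.apply_ne_zero b q.1 q.2 hq)
  simpa only [div_eq_mul_inv] using h1

theorem isKNSol (hW : IsOpen W) (h : IsStep W u v w p) (hu : SmoothField W u)
    (hv : SmoothField W v) (hKN : IsKNSol W u v) :
    IsKNSol W (fun x t => v x t - w * dX (fun y s => p y s 1 / p y s 0) x t)
      (fun x t => u x t - w * dX (fun y s => p y s 0 / p y s 1) x t) := by
  have h1 := (h.isLaxSol.isRiccati h.ne_zero (h.apply_ne_zero 0)).kaupNewell hW Complex.I_sq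
    h.ne_zero hu hv (fun x t hx => (hKN x t hx).1)
    (fun x t hx => div_ne_zero (h.apply_ne_zero 1 x t hx) (h.apply_ne_zero 0 x t hx))
    (s := fun x t => p x t 0 / p x t 1) (fun x t _ => by simp)
    (fun x t _ => rfl) (fun x t _ => rfl)
  have h2 := (h.isLaxSol.isRiccati_swap h.ne_zero (h.apply_ne_zero 1)).kaupNewell hW
    (by simp) h.ne_zero hv hu (fun x t hx => by
      have := (hKN x t hx).2
      simp only [mul_comm (u _ _)] at this
      linear_combination this)
    (fun x t hx => div_ne_zero (h.apply_ne_zero 0 x t hx) (h.apply_ne_zero 1 x t hx))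
    (s := fun x t => p x t 1 / p x t 0) (fun x t _ => by simp)
    (fun x t _ => rfl) (fun x t _ => rfl)
  refine fun x t hx => ⟨h1 x t hx, ?_⟩
  have h3 := h2 x t hx
  simp only [mul_comm (_ ^ 2)] at h3
  linear_combination h3

theorem intertwines (hW : IsOpen W) (h : IsStep W u v w p) (hu : SmoothField W u)
    (hv : SmoothField W v) {z : ℂ} (hz : z ≠ 0) :
    Intertwines W u v (fun x t => v x t - w * dX (fun y s => p y s 1 / p y s 0) x t)
      (fun x t => u x t - w * dX (fun y s => p y s 0 / p y s 1) x t) z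
      fun x t => eDT w (p x t) z := by
  have hw := h.ne_zero
  have hr := h.isLaxSol.isRiccati h.ne_zero (h.apply_ne_zero 0)
  have hs := h.isLaxSol.isRiccati_swap h.ne_zero (h.apply_ne_zero 1)
  set r : ℝ → ℝ → ℂ := fun x t => p x t 1 / p x t 0 with hrd
  set s : ℝ → ℝ → ℂ := fun x t => p x t 0 / p x t 1 with hsd
  set u' : ℝ → ℝ → ℂ := fun x t => v x t - w * dX r x t with hu'
  set v' : ℝ → ℝ → ℂ := fun x t => u x t - w * dX s x t with hv'
  have hdr : ∀ x t, (x, t) ∈ W → dX r x t = _ := fun x t hx => (hr x t hx).1.deriv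
  have hds : ∀ x t, (x, t) ∈ W → dX s x t = _ := fun x t hx => (hs x t hx).1.deriv
  have eu : ∀ x t, (x, t) ∈ W →
      u' x t = -2 * Complex.I / w * r x t + u x t * r x t ^ 2 := by
    intro x t hx
    rw [hu']; simp only; rw [hdr x t hx]; field_simp; ring
  have ev : ∀ x t, (x, t) ∈ W →
      v' x t = 2 * Complex.I / w * s x t + v x t * s x t ^ 2 := by
    intro x t hx
    rw [hv']; simp only; rw [hds x t hx]; field_simp; ring
  intro x t hx
  have hrs : s x t = (r x t)⁻¹ := by simp [hrd, hsd]
  have hr0 : r x t ≠ 0 := div_ne_zero (h.apply_ne_zero 1 x t hx) (h.apply_ne_zero 0 x t hx)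
  have eux : dX u' x t = -2 * Complex.I / w * dX r x t + dX u x t * r x t ^ 2
      + 2 * u x t * r x t * dX r x t := by
    have h2 := (hr x t hx).1.differentiableAt.hasDerivAt
    have h1 := (h2.const_mul (-2 * Complex.I / w)).add ((hu.hasDerivAt_dX hW hx).mul (h2.pow 2))
    refine (h1.congr_of_eventuallyEq (eventuallyEq_x hW hx eu)).deriv.trans ?_
    simp only [dX]; simp; ring
  have evx : dX v' x t = 2 * Complex.I / w * dX s x t + dX v x t * s x t ^ 2
      + 2 * v x t * s x t * dX s x t := by
    have h2 := (hs x t hx).1.differentiableAt.hasDerivAt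
    have h1 := (h2.const_mul (2 * Complex.I / w)).add ((hv.hasDerivAt_dX hW hx).mul (h2.pow 2))
    refine (h1.congr_of_eventuallyEq (eventuallyEq_x hW hx ev)).deriv.trans ?_
    simp only [dX]; simp; ring
  have hD : ∀ x t, eDT w (p x t) z = !![-w * r x t, z; z, -w * s x t] := fun x t => rfl
  simp only [hD, laxU_eq, laxV_eq]
  rw [eux, evx, eu x t hx, ev x t hx, hdr x t hx, hds x t hx]
  have hrx := (hr x t hx).1.const_mul (-w)
  have hrt := (hr x t hx).2.const_mul (-w)
  have hsx := (hs x t hx).1.const_mul (-w)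
  have hst := (hs x t hx).2.const_mul (-w)
  have hi2 : Complex.I ^ 2 = -1 := Complex.I_sq
  have hi3 : Complex.I ^ 3 = -Complex.I := by rw [pow_succ, hi2]; ring
  rw [hrs] at *
  -- Everything is now rational in `r` and the fields, and only `i² = -1` matters. Diagonal entries
  -- reproduce the Riccati equations; off the diagonal the entry is the constant `z`, so the right
  -- side must vanish.
  generalize Complex.I = i at *
  intro a b
  fin_cases a <;> fin_cases b <;> simp at *
  · constructor
    · refine hrx.congr_deriv ?_
      field_simp; ring
    · refine hrt.congr_deriv ?_
      field_simp; ring_nf; simp only [hi2, hi3]; ring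
  · constructor
    · refine (hasDerivAt_const x z).congr_deriv ?_
      field_simp; ring
    · refine (hasDerivAt_const t z).congr_deriv ?_
      field_simp; ring_nf
  · constructor
    · refine (hasDerivAt_const x z).congr_deriv ?_
      field_simp; ring
    · refine (hasDerivAt_const t z).congr_deriv ?_
      field_simp; ring_nf
  · constructor
    · refine hsx.congr_deriv ?_
      field_simp; ring
    · refine hst.congr_deriv ?_
      field_simp; ring_nf; simp only [hi2, hi3]; ring

end IsStep

end

section

/-! ### Chains of Darboux transformations -/

variable {W : Set (ℝ × ℝ)} {u v : ℝ → ℝ → ℂ} {L : Chain}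

theorem SmoothField.add {f g : ℝ → ℝ → ℂ} (hf : SmoothField W f) (hg : SmoothField W g) :
    SmoothField W fun x t => f x t + g x t := ContDiffOn.add hf hg

theorem SmoothField.const_mul {f : ℝ → ℝ → ℂ} (c : ℂ) (hf : SmoothField W f) :
    SmoothField W fun x t => c * f x t := ContDiffOn.mul contDiffOn_const hf

theorem SmoothField.mul {f g : ℝ → ℝ → ℂ} (hf : SmoothField W f) (hg : SmoothField W g) :
    SmoothField W fun x t => f x t * g x t := ContDiffOn.mul hf hg

theorem SmoothField.const (c : ℂ) : SmoothField W fun _ _ => c := contDiffOn_const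

/-- Every vector of the chain is a smooth solution, without zeros, of the Lax pair of the step at
which it is used. -/
def IsDarbouxChain (W : Set (ℝ × ℝ)) (u v : ℝ → ℝ → ℂ) : Chain → Prop
  | [] => True
  | e :: L => IsDarbouxChain W u v L ∧
      IsStep W (dtFields u v L).1 (dtFields u v L).2 e.1 e.2

namespace IsDarbouxChain

theorem smooth_fields (hW : IsOpen W) (hu : SmoothField W u) (hv : SmoothField W v) :
    ∀ {L : Chain}, IsDarbouxChain W u v L →
      SmoothField W (dtFields u v L).1 ∧ SmoothField W (dtFields u v L).2
  | [], _ => ⟨hu, hv⟩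
  | e :: L, h => by
    obtain ⟨h1, h2⟩ := smooth_fields hW hu hv h.1
    constructor
    · refine (h2.add (((h.2.smooth_ratio 1 0).dX hW).const_mul (-e.1))).congr fun x t _ => ?_
      simp only [dtFields]; ring
    · refine (h1.add (((h.2.smooth_ratio 0 1).dX hW).const_mul (-e.1))).congr fun x t _ => ?_
      simp only [dtFields]; ring

theorem isKNSol (hW : IsOpen W) (hu : SmoothField W u) (hv : SmoothField W v)
    (hKN : IsKNSol W u v) : ∀ {L : Chain}, IsDarbouxChain W u v L →
      IsKNSol W (dtFields u v L).1 (dtFields u v L).2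
  | [], _ => hKN
  | _ :: _, h =>
    have hs := smooth_fields hW hu hv h.1
    h.2.isKNSol hW hs.1 hs.2 (isKNSol hW hu hv hKN h.1)

theorem intertwines (hW : IsOpen W) (hu : SmoothField W u) (hv : SmoothField W v) {z : ℂ}
    (hz : z ≠ 0) : ∀ {L : Chain}, IsDarbouxChain W u v L →
      Intertwines W u v (dtFields u v L).1 (dtFields u v L).2 z (dtProd L z)
  | [], _ => Intertwines.one z
  | e :: L, h => by
    have hs := smooth_fields hW hu hv h.1
    have h1 := (h.2.intertwines hW hs.1 hs.2 hz).mul (intertwines hW hu hv hz h.1)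
    have h2 : dtProd (e :: L) z = fun x t => eDT e.1 (e.2 x t) z * dtProd L z x t := by
      funext x t; simp [dtProd]
    rw [h2]; exact h1

end IsDarbouxChain

/-! ### Products of Darboux matrices as polynomials in the spectral parameter -/

theorem dtProd_cons (e : ℂ × (ℝ → ℝ → Fin 2 → ℂ)) (L : Chain) (z : ℂ) (x t : ℝ) :
    dtProd (e :: L) z x t = eDT e.1 (e.2 x t) z * dtProd L z x t := by
  simp [dtProd]

/-- In `Fin 2` the other index is `1 - a`; this form treats both rows, and later both determinant
formulas, at once. -/
theorem eDT_mulVec (w : ℂ) (p : Fin 2 → ℂ) (z : ℂ) (ψ : Fin 2 → ℂ) (a : Fin 2) :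
    (eDT w p z *ᵥ ψ) a = -w * (p (1 - a) / p a) * ψ a + z * ψ (1 - a) := by
  fin_cases a
  · simp [eDT, Matrix.mulVec, dotProduct, Fin.sum_univ_two]
  · simp [eDT, Matrix.mulVec, dotProduct, Fin.sum_univ_two]; ring

theorem det_eDT (w : ℂ) (p : Fin 2 → ℂ) (hp : ∀ a, p a ≠ 0) (z : ℂ) :
    (eDT w p z).det = w ^ 2 - z ^ 2 := by
  have h0 := hp 0
  have h1 := hp 1
  simp [eDT, Matrix.det_fin_two_of]
  field_simp

/-- The coefficient of `z ^ k` in row `a` of the product of the Darboux matrices of a chain. It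
multiplies column `a` if `k` is even and column `1 - a` if `k` is odd. -/
def dtCoeff : Chain → Fin 2 → ℕ → ℝ → ℝ → ℂ
  | [], _, k, _, _ => if k = 0 then 1 else 0
  | e :: L, a, 0, x, t => -e.1 * (e.2 x t (1 - a) / e.2 x t a) * dtCoeff L a 0 x t
  | e :: L, a, k + 1, x, t =>
      -e.1 * (e.2 x t (1 - a) / e.2 x t a) * dtCoeff L a (k + 1) x t + dtCoeff L (1 - a) k x t

theorem dtCoeff_of_length_lt (x t : ℝ) : ∀ (L : Chain) (a : Fin 2) (k : ℕ), L.length < k →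
    dtCoeff L a k x t = 0
  | [], _, k, h => by simp only [List.length_nil] at h; simp [dtCoeff, h.ne']
  | e :: L, a, k + 1, h => by
    simp only [List.length_cons] at h
    simp [dtCoeff, dtCoeff_of_length_lt x t L a (k + 1) (by omega),
      dtCoeff_of_length_lt x t L (1 - a) k (by omega)]

theorem dtCoeff_length (x t : ℝ) : ∀ (L : Chain) (a : Fin 2), dtCoeff L a L.length x t = 1
  | [], _ => by simp [dtCoeff]
  | e :: L, a => by
    simp [dtCoeff, dtCoeff_length x t L, dtCoeff_of_length_lt x t L a (L.length + 1) (by omega)]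

/-- A new factor scales row `a` by its diagonal entry and adds `z` times row `1 - a`. The shift in
degree and the change of row together preserve the parity rule. -/
theorem dtProd_mulVec (z : ℂ) (x t : ℝ) (ψ : Fin 2 → ℂ) : ∀ (L : Chain) (a : Fin 2),
    (dtProd L z x t *ᵥ ψ) a = ∑ k ∈ Finset.range (L.length + 1),
      dtCoeff L a k x t * (z ^ k * if Even k then ψ a else ψ (1 - a))
  | [], a => by simp [dtProd, dtCoeff]
  | e :: L, a => by
    rw [dtProd_cons, ← Matrix.mulVec_mulVec, eDT_mulVec, dtProd_mulVec z x t ψ L a,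
      dtProd_mulVec z x t ψ L (1 - a), List.length_cons, Finset.sum_range_succ' _ (L.length + 1)]
    -- Split off `k = 0` and append the zero coefficient of degree `L.length + 1`, to align this sum
    -- with the shifted one.
    have h1 : ∑ k ∈ Finset.range (L.length + 1),
        dtCoeff L a k x t * (z ^ k * if Even k then ψ a else ψ (1 - a)) =
        ∑ k ∈ Finset.range (L.length + 1), dtCoeff L a (k + 1) x t *
          (z ^ (k + 1) * if Even (k + 1) then ψ a else ψ (1 - a)) + dtCoeff L a 0 x t * ψ a := by
      have h2 := Finset.sum_range_succ' (fun k => dtCoeff L a k x t *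
        (z ^ k * if Even k then ψ a else ψ (1 - a))) (L.length + 1)
      rw [Finset.sum_range_succ, dtCoeff_of_length_lt x t L a _ (Nat.lt_succ_self _)] at h2
      simpa using h2
    rw [h1, mul_add, Finset.mul_sum, Finset.mul_sum, add_right_comm, ← Finset.sum_add_distrib]
    congr 1
    · refine Finset.sum_congr rfl fun k _ => ?_
      simp only [dtCoeff, Nat.even_add_one, sub_sub_cancel]
      split_ifs <;> simp_all <;> ring
    · simp only [dtCoeff]; simp; ring

/-- The coefficient of `z ^ (N - 1)` in row `a` of the product of a chain of length `N ≠ 0`. -/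
def dtSubleading : Chain → Fin 2 → ℝ → ℝ → ℂ
  | [], _, _, _ => 0
  | e :: L, a, x, t => -e.1 * (e.2 x t (1 - a) / e.2 x t a) + dtSubleading L (1 - a) x t

/-- To lose one power of `z`, exactly one factor contributes its diagonal entry; every other factor
contributes `z` and flips the row index. -/
theorem dtCoeff_pred_length (x t : ℝ) : ∀ (L : Chain) (a : Fin 2), L ≠ [] →
    dtCoeff L a (L.length - 1) x t = dtSubleading L a x t
  | [e], a, _ => by simp [dtCoeff, dtSubleading]
  | e :: e' :: L, a, _ => by
    have h := dtCoeff_pred_length x t (e' :: L) (1 - a) (by simp)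
    have h' := dtCoeff_length x t (e' :: L) a
    simp only [List.length_cons, Nat.add_sub_cancel] at h h' ⊢
    rw [dtCoeff, h, h', mul_one]
    rfl

theorem IsDarbouxChain.smooth_dtSubleading : ∀ {L : Chain}, IsDarbouxChain W u v L →
    ∀ a, SmoothField W (dtSubleading L a)
  | [], _, _ => SmoothField.const 0
  | e :: _, h, a =>
    ((h.2.smooth_ratio (1 - a) a).const_mul (-e.1)).add (smooth_dtSubleading h.1 (1 - a))

/-- A step interchanges the two fields and adds the `x`-derivative of its diagonal entry;
`dtSubleading` accumulates these entries with the same alternation of indices. -/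
theorem IsDarbouxChain.dtFields_eq (hW : IsOpen W) :
    ∀ {L : Chain}, IsDarbouxChain W u v L → ∀ x t, (x, t) ∈ W →
      (dtFields u v L).1 x t = (if Even L.length then u x t else v x t)
        + dX (dtSubleading L 0) x t ∧
      (dtFields u v L).2 x t = (if Even L.length then v x t else u x t)
        + dX (dtSubleading L 1) x t
  | [], _, x, t, _ => by simp [dtFields, dX, dtSubleading]
  | e :: L, h, x, t, hx => by
    have ih := dtFields_eq hW h.1 x t hx
    have hd : ∀ a, dX (dtSubleading (e :: L) a) x t =
        -e.1 * dX (fun y s => e.2 y s (1 - a) / e.2 y s a) x t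
          + dX (dtSubleading L (1 - a)) x t := fun a =>
      ((((h.2.smooth_ratio (1 - a) a).hasDerivAt_dX hW hx).const_mul (-e.1)).add
        ((h.1.smooth_dtSubleading (1 - a)).hasDerivAt_dX hW hx)).deriv
    simp only [dtFields, hd, List.length_cons, Nat.even_add_one, ih, sub_zero, sub_self]
    constructor <;> split_ifs <;> ring

end

section

/-! ### Taylor coefficients in the spectral parameter -/

/-- The coefficient of `(z - w) ^ j` in the Taylor expansion of `F` at `w`. -/
def taylorCoeff (j : ℕ) (F : ℂ → ℂ) (w : ℂ) : ℂ := ((j.factorial : ℂ)⁻¹) * iteratedDeriv j F w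

section taylor

variable {F G : ℂ → ℂ} {w : ℂ}

theorem taylorCoeff_add (j : ℕ) (hF : AnalyticAt ℂ F w) (hG : AnalyticAt ℂ G w) :
    taylorCoeff j (fun z => F z + G z) w = taylorCoeff j F w + taylorCoeff j G w := by
  simp only [taylorCoeff]
  rw [iteratedDeriv_fun_add hF.contDiffAt hG.contDiffAt, mul_add]

theorem taylorCoeff_const_mul (j : ℕ) (c : ℂ) :
    taylorCoeff j (fun z => c * F z) w = c * taylorCoeff j F w := by
  simp only [taylorCoeff]
  rw [iteratedDeriv_const_mul_field]
  ring

theorem taylorCoeff_sum {ι : Type*} (s : Finset ι) {F : ι → ℂ → ℂ} (j : ℕ)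
    (hF : ∀ i ∈ s, AnalyticAt ℂ (F i) w) :
    taylorCoeff j (fun z => ∑ i ∈ s, F i z) w = ∑ i ∈ s, taylorCoeff j (F i) w := by
  simp only [taylorCoeff]
  rw [iteratedDeriv_fun_sum fun i hi => (hF i hi).contDiffAt, Finset.mul_sum]

theorem taylorCoeff_zero : taylorCoeff 0 F w = F w := by simp [taylorCoeff]

theorem iteratedDeriv_sub_const (w : ℂ) (i : ℕ) :
    iteratedDeriv i (fun z : ℂ => z - w) w = if i = 1 then 1 else 0 := by
  match i with
  | 0 => simp
  | i + 1 =>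
    have : deriv (fun z : ℂ => z - w) = fun _ => 1 := by ext z; simp
    rw [iteratedDeriv_succ', this, iteratedDeriv_const]
    simp

theorem taylorCoeff_succ_sub_mul (j : ℕ) (hF : AnalyticAt ℂ F w) :
    taylorCoeff (j + 1) (fun z => (z - w) * F z) w = taylorCoeff j F w := by
  have h : AnalyticAt ℂ (fun z : ℂ => z - w) w := by fun_prop
  simp only [taylorCoeff]
  rw [iteratedDeriv_fun_mul h.contDiffAt hF.contDiffAt, Finset.sum_eq_single 1]
  · rw [iteratedDeriv_sub_const, if_pos rfl, Nat.factorial_succ]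
    have h1 : (j.factorial : ℂ) ≠ 0 := Nat.cast_ne_zero.2 j.factorial_ne_zero
    have h2 : ((j + 1 : ℕ) : ℂ) ≠ 0 := Nat.cast_ne_zero.2 (by omega)
    simp only [Nat.choose_one_right, Nat.add_sub_cancel, Nat.cast_mul]
    field_simp
  · intro i _ hi
    rw [iteratedDeriv_sub_const, if_neg hi]; ring
  · intro h; simp at h

theorem taylorCoeff_congr (j : ℕ) (h : F =ᶠ[𝓝 w] G) : taylorCoeff j F w = taylorCoeff j G w := by
  simp only [taylorCoeff]
  rw [h.iteratedDeriv_eq]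

theorem taylorCoeff_eq_zero_iff (j : ℕ) : taylorCoeff j F w = 0 ↔ iteratedDeriv j F w = 0 := by
  simp [taylorCoeff, Nat.factorial_ne_zero]

theorem taylorCoeff_pow_mul (j : ℕ) (hF : AnalyticAt ℂ F w) :
    taylorCoeff j (fun z => (z - w) ^ j * F z) w = F w := by
  induction j with
  | zero => simp [taylorCoeff_zero]
  | succ j ih =>
    have h2 : AnalyticAt ℂ (fun z => (z - w) ^ j * F z) w := by fun_prop
    rw [← ih, ← taylorCoeff_succ_sub_mul j h2]
    congr 1
    ext z
    ring

theorem exists_eq_pow_mul_of_taylorCoeff (hF : AnalyticAt ℂ F w) {j : ℕ}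
    (h : ∀ k < j, taylorCoeff k F w = 0) :
    ∃ g, AnalyticAt ℂ g w ∧ (∀ᶠ z in 𝓝 w, F z = (z - w) ^ j * g z) ∧
      g w = taylorCoeff j F w := by
  have h1 : (j : ℕ∞) ≤ analyticOrderAt F w :=
    (natCast_le_analyticOrderAt_iff_iteratedDeriv_eq_zero hF).2 fun k hk =>
      (taylorCoeff_eq_zero_iff k).1 (h k hk)
  obtain ⟨g, hg, hFg⟩ := (natCast_le_analyticOrderAt hF).1 h1
  simp only [smul_eq_mul] at hFg
  exact ⟨g, hg, hFg, by rw [taylorCoeff_congr j hFg, taylorCoeff_pow_mul j hg]⟩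

/-- With `(z - w) ^ j` factored out of `F`, only the value `G w` reaches order `j`. This is how the
matrices of the Lax pair become frozen at `w`. -/
theorem taylorCoeff_mul_of_vanish (hF : AnalyticAt ℂ F w) (hG : AnalyticAt ℂ G w) {j : ℕ}
    (h : ∀ k < j, taylorCoeff k F w = 0) :
    taylorCoeff j (fun z => G z * F z) w = G w * taylorCoeff j F w := by
  obtain ⟨g, hg, hFg, hgw⟩ := exists_eq_pow_mul_of_taylorCoeff hF h
  rw [← hgw, ← taylorCoeff_pow_mul j (F := fun z => G z * g z) (by fun_prop)]
  refine taylorCoeff_congr j (hFg.mono fun z hz => ?_)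
  simp only [hz]; ring

theorem tendsto_of_taylorCoeff (hF : AnalyticAt ℂ F w) {j : ℕ}
    (h : ∀ k < j, taylorCoeff k F w = 0) :
    Filter.Tendsto (fun ε : ℂ => (ε ^ j)⁻¹ * F (w + ε)) (𝓝[≠] 0) (𝓝 (taylorCoeff j F w)) := by
  obtain ⟨g, hg, hFg, hgw⟩ := exists_eq_pow_mul_of_taylorCoeff hF h
  have hc : Filter.Tendsto (fun ε : ℂ => w + ε) (𝓝 0) (𝓝 w) := by
    have : Continuous fun ε : ℂ => w + ε := by fun_prop
    simpa using this.tendsto 0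
  rw [← hgw]
  have h1 : Filter.Tendsto (fun ε : ℂ => g (w + ε)) (𝓝[≠] 0) (𝓝 (g w)) :=
    (hg.continuousAt.tendsto.comp hc).mono_left nhdsWithin_le_nhds
  refine h1.congr' ?_
  filter_upwards [nhdsWithin_le_nhds (hc.eventually hFg), self_mem_nhdsWithin] with ε h2 h3
  have h4 : ε ≠ 0 := h3
  rw [h2]
  field_simp
  simp

end taylor

theorem iteratedDeriv_apply {F : ℂ → Fin 2 → ℂ} {w : ℂ}
    (hF : ∀ a, AnalyticAt ℂ (fun z => F z a) w) (j : ℕ) (a : Fin 2) :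
    iteratedDeriv j F w a = iteratedDeriv j (fun z => F z a) w := by
  have h : ContDiffAt ℂ j F w := contDiffAt_pi.2 fun a => (hF a).contDiffAt
  have h1 := (ContinuousLinearMap.proj (R := ℂ) (φ := fun _ : Fin 2 => ℂ) a).iteratedFDeriv_comp_left
    h (i := j) le_rfl
  simp only [iteratedDeriv]
  exact (congrArg (fun m => m fun _ => (1 : ℂ)) h1).symm

/-- The Taylor coefficients of `eDT e p z *ᵥ F z` at `w`. -/
theorem taylorCoeff_eDT_mulVec {F : ℂ → Fin 2 → ℂ} {w : ℂ}
    (hF : ∀ a, AnalyticAt ℂ (fun z => F z a) w) (e : ℂ) (p : Fin 2 → ℂ) (k : ℕ) (a : Fin 2) :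
    taylorCoeff k (fun z => (eDT e p z *ᵥ F z) a) w =
      (eDT e p w *ᵥ fun b => taylorCoeff k (fun z => F z b) w) a
      + if k = 0 then 0 else taylorCoeff (k - 1) (fun z => F z (1 - a)) w := by
  -- Writing `z = w + (z - w)` separates the value at `w` from the `σ₁` part.
  have h1 : (fun z => (eDT e p z *ᵥ F z) a) = fun z => (-e * (p (1 - a) / p a) * F z a
      + w * F z (1 - a)) + (z - w) * F z (1 - a) := by
    ext z; rw [eDT_mulVec]; ring
  have ha := hF a
  have hb := hF (1 - a)
  rw [h1, taylorCoeff_add _ (by fun_prop) (by fun_prop),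
    taylorCoeff_add _ (by fun_prop) (by fun_prop), taylorCoeff_const_mul, taylorCoeff_const_mul,
    eDT_mulVec]
  congr 1
  match k with
  | 0 => simp [taylorCoeff_zero]
  | k + 1 => simp [taylorCoeff_succ_sub_mul k hb]

theorem analyticAt_dtProd_mulVec {F : ℂ → Fin 2 → ℂ} {w : ℂ}
    (hF : ∀ a, AnalyticAt ℂ (fun z => F z a) w) (L : Chain) (x t : ℝ) (a : Fin 2) :
    AnalyticAt ℂ (fun z => (dtProd L z x t *ᵥ F z) a) w := by
  simp only [dtProd_mulVec]
  refine Finset.analyticAt_fun_sum _ fun k _ => ?_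
  have ha := hF a
  have hb := hF (1 - a)
  split_ifs <;> fun_prop

/-! ### The sums `Ω` -/

theorem omega_nil (l : ℕ) (z : ℂ) (x t : ℝ) : omega [] l z x t = if l = 0 then 1 else 0 := by
  simp only [omega, Finset.sum_filter]
  rw [Fintype.sum_eq_single (fun k => k.elim0) fun δ hδ => absurd (funext fun k => k.elim0) hδ]
  simp [eq_comm]

/-- Splitting by the exponent of the head gives the Leibniz recursion for multiplication by a factor
`D + ε σ₁`. -/
theorem omega_cons (e : ℂ × (ℝ → ℝ → Fin 2 → ℂ)) (L : Chain) (l : ℕ) (z : ℂ) (x t : ℝ) :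
    omega (e :: L) l z x t = eDT e.1 (e.2 x t) z * omega L l z x t
      + if l = 0 then 0 else sigma1 * omega L (l - 1) z x t := by
  simp only [omega, Finset.sum_filter]
  refine ((Fin.consEquiv fun _ : Fin (L.length + 1) => Fin 2).sum_comp _).symm.trans ?_
  rw [Fintype.sum_prod_type, Fin.sum_univ_two]
  simp only [Fin.consEquiv_apply, List.length_cons, Fin.sum_univ_succ, Fin.cons_zero,
    Fin.cons_succ, List.ofFn_succ, List.prod_cons, List.get_cons_zero]
  congr 1
  · rw [Finset.mul_sum]
    refine Finset.sum_congr rfl fun δ _ => ?_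
    simp [mul_ite]
  · match l with
    | 0 => simp
    | l + 1 =>
      rw [if_neg (Nat.succ_ne_zero l), Finset.mul_sum]
      refine Finset.sum_congr rfl fun δ _ => ?_
      simp [mul_ite, add_comm 1]

theorem sigma1_mulVec (ψ : Fin 2 → ℂ) (a : Fin 2) : (sigma1 *ᵥ ψ) a = ψ (1 - a) := by
  fin_cases a <;> simp [sigma1, Matrix.mulVec, dotProduct, Fin.sum_univ_two]

/-- The defining sum is the Cauchy product of the expansions of the Darboux product and of the seed.
Both sides obey the same recursion along the chain. -/
theorem nextVector_apply {f : ℂ → ℝ → ℝ → Fin 2 → ℂ} {w : ℂ} {x t : ℝ}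
    (hf : ∀ a, AnalyticAt ℂ (fun z => f z x t a) w) (L : Chain) (j : ℕ) (a : Fin 2) :
    nextVector L w f j x t a = taylorCoeff j (fun z => (dtProd L z x t *ᵥ f z x t) a) w := by
  have h0 : ∀ (L : Chain) j a, nextVector L w f j x t a = ∑ l ∈ Finset.range (j + 1),
      (omega L (j - l) w x t *ᵥ fun b => taylorCoeff l (fun z => f z x t b) w) a := by
    intro L j a
    rw [nextVector, Finset.sum_apply]
    refine Finset.sum_congr rfl fun l _ => ?_
    rw [← Matrix.mulVec_smul]
    congr 2
    ext b
    simp [iteratedDeriv_apply hf]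
  induction L generalizing j a with
  | nil =>
    rw [h0, Finset.sum_eq_single j]
    · simp [omega_nil, dtProd]
    · intro l hl hlj
      rw [Finset.mem_range] at hl
      rw [omega_nil, if_neg (by omega)]; simp
    · simp
  | cons e L ih =>
    have h1 : (fun z => (dtProd (e :: L) z x t *ᵥ f z x t) a) =
        fun z => (eDT e.1 (e.2 x t) z *ᵥ (dtProd L z x t *ᵥ f z x t)) a := by
      ext z; rw [dtProd_cons, Matrix.mulVec_mulVec]
    rw [h1, taylorCoeff_eDT_mulVec fun a => analyticAt_dtProd_mulVec hf L x t a]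
    simp only [← ih]
    rw [h0]
    simp only [omega_cons, Matrix.add_mulVec, Pi.add_apply, Finset.sum_add_distrib]
    congr 1
    · simp only [eDT_mulVec, ← Matrix.mulVec_mulVec, Finset.sum_add_distrib, h0, Finset.mul_sum]
    · match j with
      | 0 => simp
      | j + 1 =>
        -- The term `l = j + 1` has weight zero left, hence no `σ₁` part; the remaining terms form
        -- the sum of order `j`.
        rw [if_neg (Nat.succ_ne_zero j), Finset.sum_range_succ, h0]
        simp only [Nat.sub_self, if_true, Matrix.zero_mulVec, Pi.zero_apply, add_zero,
          Nat.add_sub_cancel]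
        refine Finset.sum_congr rfl fun l hl => ?_
        rw [Finset.mem_range] at hl
        rw [if_neg (by omega), ← Matrix.mulVec_mulVec, sigma1_mulVec,
          show j + 1 - l - 1 = j - l by omega]

end

section

/-! ### Smooth families that are holomorphic in the spectral parameter -/

/-- `F` is smooth on `O × W` and holomorphic in the first variable. -/
structure IsHolFamily (O : Set ℂ) (W : Set (ℝ × ℝ)) (F : ℂ × (ℝ × ℝ) → ℂ) : Prop where
  smooth : ContDiffOn ℝ ∞ F (O ×ˢ W)
  hol : ∀ p ∈ W, DifferentiableOn ℂ (fun z => F (z, p)) O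

/-- The derivative with respect to the spectral parameter. -/
def zDeriv (F : ℂ × (ℝ × ℝ) → ℂ) (q : ℂ × (ℝ × ℝ)) : ℂ := deriv (fun z => F (z, q.2)) q.1

namespace IsHolFamily

variable {O : Set ℂ} {W : Set (ℝ × ℝ)} {F G : ℂ × (ℝ × ℝ) → ℂ}

theorem add (hF : IsHolFamily O W F) (hG : IsHolFamily O W G) :
    IsHolFamily O W fun q => F q + G q :=
  ⟨hF.smooth.add hG.smooth, fun p hp => (hF.hol p hp).add (hG.hol p hp)⟩

theorem mul (hF : IsHolFamily O W F) (hG : IsHolFamily O W G) :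
    IsHolFamily O W fun q => F q * G q :=
  ⟨hF.smooth.mul hG.smooth, fun p hp => (hF.hol p hp).mul (hG.hol p hp)⟩

theorem sum {ι : Type*} {s : Finset ι} {F : ι → ℂ × (ℝ × ℝ) → ℂ}
    (hF : ∀ i ∈ s, IsHolFamily O W (F i)) : IsHolFamily O W fun q => ∑ i ∈ s, F i q :=
  ⟨ContDiffOn.sum fun i hi => (hF i hi).smooth,
    fun p hp => DifferentiableOn.fun_sum fun i hi => (hF i hi).hol p hp⟩

theorem of_field {h : ℝ → ℝ → ℂ} (hh : SmoothField W h) :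
    IsHolFamily O W fun q => h q.2.1 q.2.2 :=
  ⟨ContDiffOn.comp (g := fun p : ℝ × ℝ => h p.1 p.2) hh contDiffOn_snd fun _ hq => hq.2,
    fun p _ => differentiableOn_const (h p.1 p.2)⟩

theorem of_differentiableOn (hO : IsOpen O) {c : ℂ → ℂ} (hc : DifferentiableOn ℂ c O) :
    IsHolFamily O W fun q => c q.1 :=
  ⟨ContDiffOn.comp (g := c) ((hc.contDiffOn hO).restrict_scalars ℝ) contDiffOn_fst
    fun _ hq => hq.1, fun _ _ => hc⟩

theorem contDiffAt (hO : IsOpen O) (hW : IsOpen W) (hF : IsHolFamily O W F) {q : ℂ × (ℝ × ℝ)}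
    (hq : q ∈ O ×ˢ W) : ContDiffAt ℝ ∞ F q := hF.smooth.contDiffAt ((hO.prod hW).mem_nhds hq)

theorem analyticAt (hO : IsOpen O) (hF : IsHolFamily O W F) {z : ℂ} {p : ℝ × ℝ} (hz : z ∈ O)
    (hp : p ∈ W) : AnalyticAt ℂ (fun z => F (z, p)) z :=
  (hF.hol p hp).analyticAt (hO.mem_nhds hz)

/-- Identifying the complex derivative with a real directional derivative transfers joint smoothness
and the symmetry of second derivatives to it. -/
theorem zDeriv_eq (hO : IsOpen O) (hW : IsOpen W) (hF : IsHolFamily O W F) {q : ℂ × (ℝ × ℝ)}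
    (hq : q ∈ O ×ˢ W) : zDeriv F q = fderiv ℝ F q (1, 0) := by
  have h1 := ((hF.contDiffAt hO hW hq).differentiableAt (by simp)).hasFDerivAt
  have h2 : HasFDerivAt (fun z : ℂ => (z, q.2)) (ContinuousLinearMap.inl ℝ ℂ (ℝ × ℝ)) q.1 :=
    hasFDerivAt_prodMk_left q.1 q.2
  have h3 := HasFDerivAt.comp q.1 (g := F) h1 h2
  have h4 := ((hF.hol q.2 hq.2).differentiableAt (hO.mem_nhds hq.1)).hasDerivAt
  have h5 := (h4.hasFDerivAt.restrictScalars ℝ).unique h3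
  simpa [zDeriv] using congrArg (fun l => l 1) h5

protected theorem zDeriv (hO : IsOpen O) (hW : IsOpen W) (hF : IsHolFamily O W F) :
    IsHolFamily O W (zDeriv F) := by
  constructor
  · have h1 : ContDiffOn ℝ ∞ (fun q => fderiv ℝ F q ((1, 0) : ℂ × (ℝ × ℝ))) (O ×ˢ W) :=
      (hF.smooth.fderiv_of_isOpen (hO.prod hW) (by simp)).clm_apply contDiffOn_const
    exact h1.congr fun q hq => hF.zDeriv_eq hO hW hq
  · intro p hp
    exact (hF.hol p hp).deriv hO

/-- The derivative in the spectral parameter commutes with the derivatives in `(x, t)`. -/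
theorem fderiv_zDeriv (hO : IsOpen O) (hW : IsOpen W) (hF : IsHolFamily O W F)
    (hG : IsHolFamily O W G) {e : ℝ × ℝ} (h : ∀ q ∈ O ×ˢ W, fderiv ℝ F q (0, e) = G q)
    {q : ℂ × (ℝ × ℝ)} (hq : q ∈ O ×ˢ W) : fderiv ℝ (zDeriv F) q (0, e) = zDeriv G q := by
  have hn := (hO.prod hW).mem_nhds hq
  have hs := (hF.contDiffAt hO hW hq).isSymmSndFDerivAt
    (by simpa using WithTop.coe_le_coe.2 (le_top : (2 : ℕ∞) ≤ ⊤))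
  have hd : DifferentiableAt ℝ (fderiv ℝ F) q :=
    ((hF.contDiffAt hO hW hq).fderiv_right (m := 1) (by norm_cast)).differentiableAt (by simp)
  have key : ∀ d : ℂ × (ℝ × ℝ), ∀ d', fderiv ℝ (fun q => fderiv ℝ F q d) q d' =
      fderiv ℝ (fderiv ℝ F) q d' d := by
    intro d d'
    rw [fderiv_clm_apply hd (differentiableAt_const d)]
    simp
  have e1 : zDeriv F =ᶠ[𝓝 q] fun q => fderiv ℝ F q (1, 0) :=
    Filter.eventually_of_mem hn fun q hq => hF.zDeriv_eq hO hW hq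
  have e2 : G =ᶠ[𝓝 q] fun q => fderiv ℝ F q (0, e) :=
    Filter.eventually_of_mem hn fun q hq => (h q hq).symm
  rw [hG.zDeriv_eq hO hW hq, e1.fderiv_eq, e2.fderiv_eq, key, key]
  exact hs _ _

theorem iterate (hO : IsOpen O) (hW : IsOpen W) (hF : IsHolFamily O W F) (k : ℕ) :
    IsHolFamily O W (zDeriv^[k] F) := by
  induction k with
  | zero => exact hF
  | succ k ih => rw [Function.iterate_succ_apply']; exact ih.zDeriv hO hW

theorem fderiv_iterate (hO : IsOpen O) (hW : IsOpen W) (hF : IsHolFamily O W F)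
    (hG : IsHolFamily O W G) {e : ℝ × ℝ} (h : ∀ q ∈ O ×ˢ W, fderiv ℝ F q (0, e) = G q) (k : ℕ) :
    ∀ q ∈ O ×ˢ W, fderiv ℝ (zDeriv^[k] F) q (0, e) = zDeriv^[k] G q := by
  induction k with
  | zero => exact h
  | succ k ih =>
    intro q hq
    simp only [Function.iterate_succ_apply']
    exact (hF.iterate hO hW k).fderiv_zDeriv hO hW (hG.iterate hO hW k) ih hq

theorem iteratedDeriv_eq (F : ℂ × (ℝ × ℝ) → ℂ) (k : ℕ) (p : ℝ × ℝ) :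
    iteratedDeriv k (fun z => F (z, p)) = fun z => zDeriv^[k] F (z, p) := by
  induction k with
  | zero => simp
  | succ k ih => rw [iteratedDeriv_succ, ih, Function.iterate_succ_apply']; rfl

theorem smooth_slice (hF : IsHolFamily O W F) {w : ℂ} (hw : w ∈ O) :
    SmoothField W fun x t => F (w, (x, t)) :=
  ContDiffOn.comp (g := F) hF.smooth (contDiffOn_const.prodMk contDiffOn_id)
    fun _ hp => ⟨hw, hp⟩

theorem smooth_taylorCoeff (hO : IsOpen O) (hW : IsOpen W) (hF : IsHolFamily O W F) {w : ℂ}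
    (hw : w ∈ O) (k : ℕ) :
    SmoothField W fun x t => taylorCoeff k (fun z => F (z, (x, t))) w := by
  simp only [taylorCoeff, iteratedDeriv_eq F]
  exact ((hF.iterate hO hW k).smooth_slice hw).const_mul _

theorem fderiv_slice (hO : IsOpen O) (hW : IsOpen W) (hF : IsHolFamily O W F) {w : ℂ}
    (hw : w ∈ O) {p : ℝ × ℝ} (hp : p ∈ W) (e : ℝ × ℝ) :
    fderiv ℝ (fun p : ℝ × ℝ => F (w, (p.1, p.2))) p e = fderiv ℝ F (w, p) (0, e) := by
  have h1 := ((hF.contDiffAt hO hW (q := (w, p)) ⟨hw, hp⟩).differentiableAt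
    (by simp)).hasFDerivAt
  have h2 : HasFDerivAt (fun p : ℝ × ℝ => (w, p)) (ContinuousLinearMap.inr ℝ ℂ (ℝ × ℝ)) p :=
    hasFDerivAt_prodMk_right w p
  have h3 := HasFDerivAt.comp p (g := F) h1 h2
  simpa [Function.comp_def] using congrArg (fun l => l e) h3.fderiv

/-- This lets a differential equation valid for all nearby `z` be read off coefficient by
coefficient. -/
theorem hasDerivAt_taylorCoeff_x (hO : IsOpen O) (hW : IsOpen W) (hF : IsHolFamily O W F)
    (hG : IsHolFamily O W G) (h : ∀ z ∈ O, ∀ x t, (x, t) ∈ W →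
      HasDerivAt (fun y => F (z, (y, t))) (G (z, (x, t))) x) {w : ℂ} (hw : w ∈ O) (k : ℕ)
    {x t : ℝ} (hx : (x, t) ∈ W) :
    HasDerivAt (fun y => taylorCoeff k (fun z => F (z, (y, t))) w)
      (taylorCoeff k (fun z => G (z, (x, t))) w) x := by
  have h1 : ∀ q ∈ O ×ˢ W, fderiv ℝ F q (0, (1, 0)) = G q := by
    rintro ⟨z, x, t⟩ ⟨hz, hx⟩
    rw [← hF.fderiv_slice hO hW hz hx]
    exact ((hF.smooth_slice hz).hasDerivAt_fderiv_x hW hx).unique (h z hz x t hx)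
  have h2 := hF.iterate hO hW k
  simp only [taylorCoeff, iteratedDeriv_eq F, iteratedDeriv_eq G]
  refine HasDerivAt.const_mul _ ?_
  rw [← hF.fderiv_iterate hO hW hG h1 k _ ⟨hw, hx⟩, ← h2.fderiv_slice hO hW hw hx]
  exact (h2.smooth_slice hw).hasDerivAt_fderiv_x hW hx

theorem hasDerivAt_taylorCoeff_t (hO : IsOpen O) (hW : IsOpen W) (hF : IsHolFamily O W F)
    (hG : IsHolFamily O W G) (h : ∀ z ∈ O, ∀ x t, (x, t) ∈ W →
      HasDerivAt (fun s => F (z, (x, s))) (G (z, (x, t))) t) {w : ℂ} (hw : w ∈ O) (k : ℕ)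
    {x t : ℝ} (hx : (x, t) ∈ W) :
    HasDerivAt (fun s => taylorCoeff k (fun z => F (z, (x, s))) w)
      (taylorCoeff k (fun z => G (z, (x, t))) w) t := by
  have h1 : ∀ q ∈ O ×ˢ W, fderiv ℝ F q (0, (0, 1)) = G q := by
    rintro ⟨z, x, t⟩ ⟨hz, hx⟩
    rw [← hF.fderiv_slice hO hW hz hx]
    exact ((hF.smooth_slice hz).hasDerivAt_fderiv_t hW hx).unique (h z hz x t hx)
  have h2 := hF.iterate hO hW k
  simp only [taylorCoeff, iteratedDeriv_eq F, iteratedDeriv_eq G]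
  refine HasDerivAt.const_mul _ ?_
  rw [← hF.fderiv_iterate hO hW hG h1 k _ ⟨hw, hx⟩, ← h2.fderiv_slice hO hW hw hx]
  exact (h2.smooth_slice hw).hasDerivAt_fderiv_t hW hx

end IsHolFamily

end

section

/-! ### The vectors built from a seed -/

variable {W : Set (ℝ × ℝ)} {u v : ℝ → ℝ → ℂ} {f : ℂ → ℝ → ℝ → Fin 2 → ℂ} {w : ℂ}

theorem IsSeed.ne_zero (h : IsSeed W u v w f) : w ≠ 0 := by
  obtain ⟨O, -, hw, h0, -⟩ := h
  rintro rfl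
  exact h0 hw

theorem IsSeed.analyticAt (h : IsSeed W u v w f) {x t : ℝ} (hx : (x, t) ∈ W) (a : Fin 2) :
    AnalyticAt ℂ (fun z => f z x t a) w := by
  obtain ⟨O, hO, hw, -, -, hd, -⟩ := h
  exact (differentiableOn_pi.1 (hd x t hx) a).analyticAt (hO.mem_nhds hw)

theorem IsDarbouxChain.smooth_dtCoeff : ∀ {L : Chain}, IsDarbouxChain W u v L →
    ∀ a k, SmoothField W (dtCoeff L a k)
  | [], _, _, _ => SmoothField.const _
  | e :: _, h, a, 0 =>
    ((h.2.smooth_ratio (1 - a) a).const_mul (-e.1)).mul (smooth_dtCoeff h.1 a 0)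
  | e :: _, h, a, k + 1 =>
    (((h.2.smooth_ratio (1 - a) a).const_mul (-e.1)).mul (smooth_dtCoeff h.1 a (k + 1))).add
      (smooth_dtCoeff h.1 (1 - a) k)

/-- `taylorCoeff k` of `dtProd L z *ᵥ f z` at `w`. -/
def dtTaylor (L : Chain) (f : ℂ → ℝ → ℝ → Fin 2 → ℂ) (w : ℂ) (k : ℕ) (x t : ℝ) (a : Fin 2) : ℂ :=
  taylorCoeff k (fun z => (dtProd L z x t *ᵥ f z x t) a) w

theorem IsDarbouxChain.isHolFamily {L : Chain} (h : IsDarbouxChain W u v L) {O : Set ℂ}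
    (hO : IsOpen O) (hf : ∀ a, IsHolFamily O W fun q => f q.1 q.2.1 q.2.2 a) (a : Fin 2) :
    IsHolFamily O W fun q => (dtProd L q.1 q.2.1 q.2.2 *ᵥ f q.1 q.2.1 q.2.2) a := by
  simp only [dtProd_mulVec]
  refine IsHolFamily.sum fun k _ => (IsHolFamily.of_field (h.smooth_dtCoeff a k)).mul
    ((IsHolFamily.of_differentiableOn hO (c := fun z => z ^ k) (by fun_prop)).mul ?_)
  split_ifs
  exacts [hf a, hf (1 - a)]

/-- The entries of the matrices of the Lax pair are holomorphic families. -/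
theorem isHolFamily_lax (hW : IsOpen W) (hu : SmoothField W u) (hv : SmoothField W v) {O : Set ℂ}
    (hO : IsOpen O) (h0 : (0 : ℂ) ∉ O) (a b : Fin 2) :
    IsHolFamily O W (fun q => laxU u v q.1 q.2.1 q.2.2 a b) ∧
    IsHolFamily O W (fun q => laxV u v q.1 q.2.1 q.2.2 a b) := by
  have hz : ∀ (c : ℂ) (n : ℕ), IsHolFamily O W fun q => c / q.1 ^ n := fun c n =>
    IsHolFamily.of_differentiableOn hO (c := fun z => c / z ^ n)
      (DifferentiableOn.div (by fun_prop) (by fun_prop) fun z hz =>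
        pow_ne_zero n (ne_of_mem_of_not_mem hz h0))
  have iu := IsHolFamily.of_field (O := O) hu
  have iv := IsHolFamily.of_field (O := O) hv
  have iux := IsHolFamily.of_field (O := O) (hu.dX hW)
  have ivx := IsHolFamily.of_field (O := O) (hv.dX hW)
  have key : ∀ {F G : ℂ × (ℝ × ℝ) → ℂ}, IsHolFamily O W F → (∀ q, G q = F q) →
      IsHolFamily O W G := fun hF h => by rwa [funext h]
  simp only [laxU_eq, laxV_eq]
  fin_cases a <;> fin_cases b <;> constructor
  · exact hz (-Complex.I) 2
  · refine key ((hz (-(2 * Complex.I)) 4).add ((hz (-Complex.I) 2).mul (iu.mul iv))) fun q => ?_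
    simp; ring
  · refine key ((hz 1 1).mul iu) fun q => ?_
    simp; ring
  · refine key (((hz 2 3).mul iu).add (((hz 1 1).mul (iu.mul (iu.mul iv))).add
      ((hz Complex.I 1).mul iux))) fun q => ?_
    simp; ring
  · refine key ((hz 1 1).mul iv) fun q => ?_
    simp; ring
  · refine key (((hz 2 3).mul iv).add (((hz 1 1).mul (iu.mul (iv.mul iv))).add
      ((hz (-Complex.I) 1).mul ivx))) fun q => ?_
    simp; ring
  · exact hz Complex.I 2
  · refine key ((hz (2 * Complex.I) 4).add ((hz Complex.I 2).mul (iu.mul iv))) fun q => ?_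
    simp; ring

theorem IsSeed.isHolFamily {O : Set ℂ}
    (hs : ContDiffOn ℝ ∞ (fun p : ℂ × (ℝ × ℝ) => f p.1 p.2.1 p.2.2) (O ×ˢ W))
    (hd : ∀ x t : ℝ, (x, t) ∈ W → DifferentiableOn ℂ (fun z => f z x t) O) (a : Fin 2) :
    IsHolFamily O W fun q => f q.1 q.2.1 q.2.2 a :=
  ⟨contDiffOn_pi.1 hs a, fun p hp => differentiableOn_pi.1 (hd p.1 p.2 hp) a⟩

theorem IsHolFamily.mulVec {O : Set ℂ} {A : ℂ × (ℝ × ℝ) → Matrix (Fin 2) (Fin 2) ℂ}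
    {ψ : ℂ × (ℝ × ℝ) → Fin 2 → ℂ} (hA : ∀ a b, IsHolFamily O W fun q => A q a b)
    (hψ : ∀ b, IsHolFamily O W fun q => ψ q b) (a : Fin 2) :
    IsHolFamily O W fun q => (A q *ᵥ ψ q) a := by
  have h : (fun q => (A q *ᵥ ψ q) a) = fun q => ∑ b, A q a b * ψ q b := rfl
  rw [h]
  exact IsHolFamily.sum fun b _ => (hA a b).mul (hψ b)

theorem IsLaxSol.congr (hW : IsOpen W) {Ψ Ψ' : ℝ → ℝ → Fin 2 → ℂ} (h : IsLaxSol W u v w Ψ)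
    (hΨ : ∀ x t, (x, t) ∈ W → Ψ' x t = Ψ x t) : IsLaxSol W u v w Ψ' := by
  intro x t hx
  rw [hΨ x t hx]
  exact ⟨(h x t hx).1.congr_of_eventuallyEq
      ((eventually_mem_x hW hx).mono fun y hy => hΨ y t hy),
    (h x t hx).2.congr_of_eventuallyEq ((eventually_mem_t hW hx).mono fun s hs => hΨ x s hs)⟩

theorem IsSeed.smooth_dtTaylor (hW : IsOpen W) {L : Chain} {u' v' : ℝ → ℝ → ℂ}
    (hL : IsDarbouxChain W u' v' L) (hf : IsSeed W u v w f) (k : ℕ) (a : Fin 2) :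
    SmoothField W fun x t => dtTaylor L f w k x t a := by
  obtain ⟨O, hO, hw, -, hs, hd, -⟩ := hf
  exact (hL.isHolFamily hO (isHolFamily hs hd) a).smooth_taylorCoeff hO hW hw k

/-- The transformed seed solves the new Lax pair at every `z` near `w`. At order `j` the
`z`-dependence of `U` and `V` would bring in lower coefficients, which vanish by `hz`. -/
theorem IsSeed.isLaxSol_dtTaylor (hW : IsOpen W) (hu : SmoothField W u) (hv : SmoothField W v)
    {L : Chain} (hL : IsDarbouxChain W u v L) (hf : IsSeed W u v w f) {j : ℕ}
    (hz : ∀ x t, (x, t) ∈ W → ∀ k < j, ∀ a, dtTaylor L f w k x t a = 0) :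
    IsLaxSol W (dtFields u v L).1 (dtFields u v L).2 w (dtTaylor L f w j) := by
  have hf' := fun {x t} hx => hf.analyticAt (x := x) (t := t) hx
  obtain ⟨O, hO, hw, h0, hs, hd, hl⟩ := hf
  have hF := hL.isHolFamily hO (isHolFamily hs hd)
  have hF' := hL.smooth_fields hW hu hv
  have hUV := isHolFamily_lax hW hF'.1 hF'.2 hO h0
  have hsol : ∀ z ∈ O, IsLaxSol W (dtFields u v L).1 (dtFields u v L).2 z
      fun x t => dtProd L z x t *ᵥ f z x t := fun z hz =>
    (hL.intertwines hW hu hv (ne_of_mem_of_not_mem hz h0)).isLaxSol (hl z hz)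
  intro x t hx
  have hFa : ∀ b, AnalyticAt ℂ (fun z => (dtProd L z x t *ᵥ f z x t) b) w :=
    analyticAt_dtProd_mulVec (hf' hx) L x t
  have expand : ∀ A : ℂ → Matrix (Fin 2) (Fin 2) ℂ, (∀ a b, AnalyticAt ℂ (fun z => A z a b) w) →
      ∀ a, taylorCoeff j (fun z => (A z *ᵥ (dtProd L z x t *ᵥ f z x t)) a) w =
        (A w *ᵥ dtTaylor L f w j x t) a := by
    intro A hA a
    have h1 := fun b => taylorCoeff_mul_of_vanish (hFa b) (hA a b) fun k hk => hz x t hx k hk b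
    have e1 : (fun z => (A z *ᵥ (dtProd L z x t *ᵥ f z x t)) a) = fun z =>
        A z a 0 * (dtProd L z x t *ᵥ f z x t) 0 + A z a 1 * (dtProd L z x t *ᵥ f z x t) 1 := by
      ext z
      rw [Matrix.mulVec, dotProduct, Fin.sum_univ_two]
    rw [e1, taylorCoeff_add j ((hA a 0).fun_mul (hFa 0)) ((hA a 1).fun_mul (hFa 1)), h1, h1]
    simp only [Matrix.mulVec, dotProduct, Fin.sum_univ_two, dtTaylor]
  constructor
  · rw [hasDerivAt_pi]
    intro a
    have hG := IsHolFamily.mulVec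
      (A := fun q => laxU (dtFields u v L).1 (dtFields u v L).2 q.1 q.2.1 q.2.2)
      (ψ := fun q => dtProd L q.1 q.2.1 q.2.2 *ᵥ f q.1 q.2.1 q.2.2)
      (fun a b => (hUV a b).1) hF a
    have key := (hF a).hasDerivAt_taylorCoeff_x hO hW hG
      (fun z hz x t hx => hasDerivAt_pi.1 (hsol z hz x t hx).1 a) hw j hx
    exact key.congr_deriv (expand (fun z => laxU (dtFields u v L).1 (dtFields u v L).2 z x t)
      (fun a b => (hUV a b).1.analyticAt (p := (x, t)) hO hw hx) a)
  · rw [hasDerivAt_pi]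
    intro a
    have hG := IsHolFamily.mulVec
      (A := fun q => laxV (dtFields u v L).1 (dtFields u v L).2 q.1 q.2.1 q.2.2)
      (ψ := fun q => dtProd L q.1 q.2.1 q.2.2 *ᵥ f q.1 q.2.1 q.2.2)
      (fun a b => (hUV a b).2) hF a
    have key := (hF a).hasDerivAt_taylorCoeff_t hO hW hG
      (fun z hz x t hx => hasDerivAt_pi.1 (hsol z hz x t hx).2 a) hw j hx
    exact key.congr_deriv (expand (fun z => laxV (dtFields u v L).1 (dtFields u v L).2 z x t)
      (fun a b => (hUV a b).2.analyticAt (p := (x, t)) hO hw hx) a)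

/-! ### Zeros of the transformed seeds -/

section zeros

variable {x t : ℝ}

theorem dtTaylor_cons (hf : ∀ a, AnalyticAt ℂ (fun z => f z x t a) w)
    (e : ℂ × (ℝ → ℝ → Fin 2 → ℂ)) (L : Chain) (k : ℕ) (a : Fin 2) :
    dtTaylor (e :: L) f w k x t a = (eDT e.1 (e.2 x t) w *ᵥ dtTaylor L f w k x t) a
      + if k = 0 then 0 else dtTaylor L f w (k - 1) x t (1 - a) := by
  simp only [dtTaylor, dtProd_cons, ← Matrix.mulVec_mulVec]
  exact taylorCoeff_eDT_mulVec (fun a => analyticAt_dtProd_mulVec hf L x t a) _ _ _ _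

theorem nextVector_eq (hf : ∀ a, AnalyticAt ℂ (fun z => f z x t a) w) (L : Chain) (j : ℕ) :
    nextVector L w f j x t = dtTaylor L f w j x t :=
  funext fun a => nextVector_apply hf L j a

theorem dtTaylor_cons_eq_zero (hf : ∀ a, AnalyticAt ℂ (fun z => f z x t a) w)
    (e : ℂ × (ℝ → ℝ → Fin 2 → ℂ)) {L : Chain} {j : ℕ}
    (h : ∀ k < j, ∀ a, dtTaylor L f w k x t a = 0) : ∀ k < j, ∀ a,
      dtTaylor (e :: L) f w k x t a = 0 := by
  intro k hk a
  rw [dtTaylor_cons hf, eDT_mulVec, h k hk, h k hk]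
  split_ifs
  · simp
  · rw [h (k - 1) (by omega)]; simp

theorem eDT_mulVec_self {p : Fin 2 → ℂ} (hp : ∀ a, p a ≠ 0) : eDT w p w *ᵥ p = 0 := by
  ext a
  have := hp a
  rw [eDT_mulVec, Pi.zero_apply]
  field_simp
  ring

theorem dtTaylor_extendChain_eq_zero (hf : ∀ a, AnalyticAt ℂ (fun z => f z x t a) w) (L : Chain) :
    ∀ j : ℕ, (∀ k < j, ∀ a, nextVector (extendChain L w f k) w f k x t a ≠ 0) →
      ∀ k < j, ∀ a, dtTaylor (extendChain L w f j) f w k x t a = 0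
  | 0, _, k, hk, _ => absurd hk (by omega)
  | j + 1, h, k, hk, a => by
    have ih := dtTaylor_extendChain_eq_zero hf L j fun k hk => h k (by omega)
    rcases Nat.lt_succ_iff_lt_or_eq.1 hk with hk | rfl
    · exact dtTaylor_cons_eq_zero hf _ ih k hk a
    -- The top order: the new factor at `w` annihilates its own vector, which is this coefficient,
    -- and `σ₁` acts on a coefficient already zero.
    · have hp := h k (by omega)
      rw [extendChain, dtTaylor_cons hf, ← nextVector_eq hf, eDT_mulVec_self hp]
      split_ifs
      · simp
      · rw [ih (k - 1) (by omega)]; simp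

theorem dtTaylor_extendChain_of_vanish {j : ℕ} {w' : ℂ} {f' : ℂ → ℝ → ℝ → Fin 2 → ℂ}
    (hf : ∀ a, AnalyticAt ℂ (fun z => f z x t a) w) {L : Chain}
    (h : ∀ k < j, ∀ a, dtTaylor L f w k x t a = 0) :
    ∀ l, ∀ k < j, ∀ a, dtTaylor (extendChain L w' f' l) f w k x t a = 0
  | 0 => h
  | l + 1 => dtTaylor_cons_eq_zero hf _ (dtTaylor_extendChain_of_vanish hf h l)

end zeros

/-- The induction closes because a valid chain of `j` steps makes the next vector a Lax solution,
which in turn validates step `j + 1`. -/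
theorem extendChain_isDarbouxChain (hW : IsOpen W) (hu : SmoothField W u) (hv : SmoothField W v)
    {L : Chain} (hL : IsDarbouxChain W u v L) (hf : IsSeed W u v w f) : ∀ j : ℕ,
    (∀ k < j, ∀ x t, (x, t) ∈ W → ∀ a, nextVector (extendChain L w f k) w f k x t a ≠ 0) →
      IsDarbouxChain W u v (extendChain L w f j)
  | 0, _ => hL
  | j + 1, h => by
    have ih := extendChain_isDarbouxChain hW hu hv hL hf j fun k hk => h k (by omega)
    refine ⟨ih, hf.ne_zero, fun a => ?_, fun a x t hx => h j (by omega) x t hx a, ?_⟩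
    · exact (hf.smooth_dtTaylor hW ih j a).congr fun x t hx =>
        congrFun (nextVector_eq (hf.analyticAt hx) _ j) a
    · exact (hf.isLaxSol_dtTaylor hW hu hv ih fun x t hx =>
        dtTaylor_extendChain_eq_zero (hf.analyticAt hx) L j fun k hk =>
          h k (by omega) x t hx).congr hW fun x t hx => nextVector_eq (hf.analyticAt hx) _ j

end

section

/-! ### The chain of the generalized Darboux transformation -/

theorem length_extendChain (L : Chain) (w : ℂ) (f : ℂ → ℝ → ℝ → Fin 2 → ℂ) (j : ℕ) :
    (extendChain L w f j).length = L.length + j := by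
  induction j with
  | zero => rfl
  | succ j ih => rw [extendChain, List.length_cons, ih]; rfl

variable {m : ℕ → ℕ} {ζ : ℕ → ℂ} {Φ : ℕ → ℂ → ℝ → ℝ → Fin 2 → ℂ}

theorem length_gdtChain (i : ℕ) : (gdtChain m ζ Φ i).length = ∑ k ∈ Finset.range i, m k := by
  induction i with
  | zero => rfl
  | succ i ih => rw [gdtChain, length_extendChain, ih, Finset.sum_range_succ]

theorem length_gdtBefore (i j : ℕ) :
    (gdtBefore m ζ Φ i j).length = ∑ k ∈ Finset.range i, m k + j := by
  rw [gdtBefore, length_extendChain, length_gdtChain]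

theorem val_finSigmaFinEquiv {n : ℕ} (s : (i : Fin n) × Fin (m i)) :
    (finSigmaFinEquiv s : ℕ) = ∑ k ∈ Finset.range s.1, m k + s.2 := by
  rw [finSigmaFinEquiv_apply, Finset.sum_range]
  rfl

theorem lex_of_finSigmaFinEquiv_lt {n : ℕ} {s c : (i : Fin n) × Fin (m i)}
    (h : finSigmaFinEquiv c < finSigmaFinEquiv s) :
    (c.1 : ℕ) < s.1 ∨ (c.1 : ℕ) = s.1 ∧ (c.2 : ℕ) < s.2 := by
  rw [Fin.lt_def, val_finSigmaFinEquiv, val_finSigmaFinEquiv] at h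
  rcases lt_trichotomy (c.1 : ℕ) s.1 with h1 | h1 | h1
  · exact Or.inl h1
  · have h2 : ∑ k ∈ Finset.range c.1, m k = ∑ k ∈ Finset.range s.1, m k := by rw [h1]
    exact Or.inr ⟨h1, by omega⟩
  · have h2 : ∑ k ∈ Finset.range (s.1 + 1), m k ≤ ∑ k ∈ Finset.range c.1, m k :=
      Finset.sum_le_sum_of_subset (Finset.range_mono h1)
    rw [Finset.sum_range_succ] at h2
    have := s.2.isLt
    omega

section facts

variable {n : ℕ} {W : Set (ℝ × ℝ)} {u v : ℝ → ℝ → ℂ}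

theorem isDarbouxChain_gdtBefore (hW : IsOpen W) (hu : SmoothField W u) (hv : SmoothField W v)
    (hΦ : ∀ i < n, IsSeed W u v (ζ i) (Φ i))
    (hne : ∀ i < n, ∀ j < m i, ∀ x t : ℝ, (x, t) ∈ W → ∀ a, gdtVector m ζ Φ i j x t a ≠ 0)
    {i : ℕ} (hi : i < n) : ∀ j ≤ m i, IsDarbouxChain W u v (gdtBefore m ζ Φ i j) := by
  have key : ∀ i < n, IsDarbouxChain W u v (gdtChain m ζ Φ i) →
      ∀ j ≤ m i, IsDarbouxChain W u v (gdtBefore m ζ Φ i j) := fun i hi hL j hj =>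
    extendChain_isDarbouxChain hW hu hv hL (hΦ i hi) j fun k hk => hne i hi k (by omega)
  have h1 : ∀ i ≤ n, IsDarbouxChain W u v (gdtChain m ζ Φ i) := by
    intro i
    induction i with
    | zero => exact fun _ => trivial
    | succ i ih => exact fun hi => key i hi (ih (by omega)) (m i) le_rfl
  exact key i hi (h1 i hi.le)

theorem isDarbouxChain_gdtChain (hW : IsOpen W) (hu : SmoothField W u) (hv : SmoothField W v)
    (hΦ : ∀ i < n, IsSeed W u v (ζ i) (Φ i))
    (hne : ∀ i < n, ∀ j < m i, ∀ x t : ℝ, (x, t) ∈ W → ∀ a, gdtVector m ζ Φ i j x t a ≠ 0) :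
    IsDarbouxChain W u v (gdtChain m ζ Φ n) := by
  match n with
  | 0 => trivial
  | n + 1 => exact isDarbouxChain_gdtBefore hW hu hv hΦ hne (Nat.lt_succ_self n) (m n) le_rfl

variable {x t : ℝ}

theorem dtTaylor_gdtBefore_self (hf : ∀ i < n, ∀ a, AnalyticAt ℂ (fun z => Φ i z x t a) (ζ i))
    (hne : ∀ i < n, ∀ j < m i, ∀ a, gdtVector m ζ Φ i j x t a ≠ 0) {i j : ℕ} (hi : i < n)
    (hj : j ≤ m i) : ∀ k < j, ∀ a, dtTaylor (gdtBefore m ζ Φ i j) (Φ i) (ζ i) k x t a = 0 :=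
  dtTaylor_extendChain_eq_zero (hf i hi) _ j fun k hk => hne i hi k (by omega)

theorem dtTaylor_gdtChain (hf : ∀ i < n, ∀ a, AnalyticAt ℂ (fun z => Φ i z x t a) (ζ i))
    (hne : ∀ i < n, ∀ j < m i, ∀ a, gdtVector m ζ Φ i j x t a ≠ 0) {i' : ℕ} (hi' : i' < n) {i : ℕ}
    (hi : i' < i) : ∀ k < m i', ∀ a, dtTaylor (gdtChain m ζ Φ i) (Φ i') (ζ i') k x t a = 0 := by
  induction i with
  | zero => omega
  | succ i ih =>
    rcases Nat.lt_succ_iff_lt_or_eq.1 hi with hi | rfl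
    · exact dtTaylor_extendChain_of_vanish (hf i' hi') (ih hi) (m i)
    · exact dtTaylor_gdtBefore_self hf hne hi' le_rfl

theorem dtTaylor_gdtBefore (hf : ∀ i < n, ∀ a, AnalyticAt ℂ (fun z => Φ i z x t a) (ζ i))
    (hne : ∀ i < n, ∀ j < m i, ∀ a, gdtVector m ζ Φ i j x t a ≠ 0) {i' : ℕ} (hi' : i' < n) {i : ℕ}
    (hi : i' < i) (j : ℕ) :
    ∀ k < m i', ∀ a, dtTaylor (gdtBefore m ζ Φ i j) (Φ i') (ζ i') k x t a = 0 :=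
  dtTaylor_extendChain_of_vanish (hf i' hi') (dtTaylor_gdtChain hf hne hi' hi) j

theorem det_extendChain {w : ℂ} {f : ℂ → ℝ → ℝ → Fin 2 → ℂ} (L : Chain) (z : ℂ) (j : ℕ)
    (h : ∀ k < j, ∀ a, nextVector (extendChain L w f k) w f k x t a ≠ 0) :
    (dtProd (extendChain L w f j) z x t).det = (dtProd L z x t).det * (w ^ 2 - z ^ 2) ^ j := by
  induction j with
  | zero => simp [extendChain]
  | succ j ih =>
    rw [extendChain, dtProd_cons, Matrix.det_mul, ih fun k hk => h k (by omega),
      det_eDT _ _ (h j (by omega))]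
    ring

theorem det_gdtChain (z : ℂ)
    (hne : ∀ i < n, ∀ j < m i, ∀ a, gdtVector m ζ Φ i j x t a ≠ 0) :
    (dtProd (gdtChain m ζ Φ n) z x t).det = ∏ i : Fin n, (ζ i ^ 2 - z ^ 2) ^ m i := by
  rw [← Finset.prod_range fun i => (ζ i ^ 2 - z ^ 2) ^ m i]
  induction n with
  | zero => simp [gdtChain, dtProd]
  | succ n ih =>
    rw [gdtChain, det_extendChain _ _ _ (hne n (by omega)), ih fun i hi => hne i (by omega),
      Finset.prod_range_succ]

end facts

/-! ### The determinants -/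

/-- If the rows of `E`, combined by a unitriangular matrix, form a triangular matrix without zeros
on the diagonal, then `det E ≠ 0`. -/
theorem det_ne_zero_of_triangularize {N : ℕ} (E : ℕ → Fin N → ℂ) (T : Fin N → ℕ → ℂ)
    (h0 : ∀ s c : Fin N, c < s → ∑ k ∈ Finset.range (s + 1), T s k * E k c = 0)
    (hd : ∀ c : Fin N, ∑ k ∈ Finset.range (c + 1), T c k * E k c ≠ 0) :
    (Matrix.of fun (k c : Fin N) => E k c).det ≠ 0 := by
  set A : Matrix (Fin N) (Fin N) ℂ := Matrix.of fun k c => E k c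
  set B : Matrix (Fin N) (Fin N) ℂ := Matrix.of fun s k => if (k : ℕ) ≤ s then T s k else 0
  have hBA : ∀ s c, (B * A) s c = ∑ k ∈ Finset.range (s + 1), T s k * E k c := by
    intro s c
    simp only [Matrix.mul_apply, A, B, Matrix.of_apply, ite_mul, zero_mul]
    rw [Fin.sum_univ_eq_sum_range (fun k => if k ≤ (s : ℕ) then T s k * E k c else 0) N,
      ← Finset.sum_filter]
    refine Finset.sum_congr ?_ fun _ _ => rfl
    ext k
    simp only [Finset.mem_filter, Finset.mem_range]
    omega
  have h1 : (B * A).det = ∏ i, (B * A) i i :=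
    Matrix.det_of_isUpperTriangular fun s c hsc => by rw [hBA]; exact h0 s c hsc
  rw [Matrix.det_mul] at h1
  -- Only `det (B * A) ≠ 0` is used, so the diagonal of `B` plays no role.
  refine right_ne_zero_of_mul (a := B.det) ?_
  rw [h1, Finset.prod_ne_zero_iff]
  intro i _
  rw [hBA]
  exact hd i

/-- The relation makes row `N` equal to `-∑ T k` times row `k` over `k < N`; put in the last place,
only the multiple of row `N - 1` survives in the determinant. -/
theorem det_replace_last {N : ℕ} (hN : 0 < N) (E : ℕ → Fin N → ℂ) (T : ℕ → ℂ) (hT : T N = 1)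
    (h0 : ∀ c : Fin N, ∑ k ∈ Finset.range (N + 1), T k * E k c = 0) :
    (Matrix.of fun (k c : Fin N) => E (if (k : ℕ) + 1 = N then k + 1 else k) c).det =
      -T (N - 1) * (Matrix.of fun (k c : Fin N) => E k c).det := by
  have key := Matrix.det_updateRow_sum (Matrix.of fun (k c : Fin N) => E k c)
    ⟨N - 1, by omega⟩ fun k => -T k
  rw [smul_eq_mul] at key
  rw [← key]
  congr 1
  ext k c
  rw [Matrix.updateRow_apply, Finset.sum_apply]
  by_cases hk : (k : ℕ) + 1 = N
  · have hk' : k = ⟨N - 1, by omega⟩ := Fin.ext (by simp only; omega)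
    rw [if_pos hk', Matrix.of_apply, if_pos hk, hk]
    have h1 := h0 c
    rw [Finset.sum_range_succ, hT, Finset.sum_range] at h1
    simp only [Pi.smul_apply, Matrix.of_apply, smul_eq_mul, neg_mul, Finset.sum_neg_distrib]
    linear_combination h1
  · have hk' : k ≠ ⟨N - 1, by omega⟩ := fun h => hk (by rw [h]; simp only; omega)
    rw [if_neg hk', Matrix.of_apply, Matrix.of_apply, if_neg hk]

section determinants

variable {n : ℕ} {x t : ℝ}

/-- The entry of the confluent matrices in the column of `(i, j)`, for the exponent `k`. -/
def confluentEntry (ζ : ℕ → ℂ) (Φ : ℕ → ℂ → ℝ → ℝ → Fin 2 → ℂ) (x t : ℝ) (a : Fin 2)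
    (i j k : ℕ) : ℂ :=
  taylorCoeff j (fun z => z ^ k * if Even k then Φ i z x t a else Φ i z x t (1 - a)) (ζ i)

theorem sum_dtCoeff_mul_confluentEntry {i : ℕ}
    (hf : ∀ a, AnalyticAt ℂ (fun z => Φ i z x t a) (ζ i)) {L : Chain} {s : ℕ}
    (hs : L.length = s) (a : Fin 2) (j : ℕ) :
    ∑ k ∈ Finset.range (s + 1), dtCoeff L a k x t * confluentEntry ζ Φ x t a i j k =
      dtTaylor L (Φ i) (ζ i) j x t a := by
  subst hs
  simp only [dtTaylor, dtProd_mulVec]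
  have ha := hf a
  have hb := hf (1 - a)
  have h1 : ∀ k, AnalyticAt ℂ
      (fun z => z ^ k * if Even k then Φ i z x t a else Φ i z x t (1 - a)) (ζ i) := by
    intro k
    split_ifs <;> fun_prop
  rw [taylorCoeff_sum _ _ fun k _ => analyticAt_const.fun_mul (h1 k)]
  simp only [taylorCoeff_const_mul, confluentEntry]

/-- `(φ, ϕ)` for `a = 0`, `(ϕ, φ)` for `a = 1`. -/
def rowSeeds (Φ : ℕ → ℂ → ℝ → ℝ → Fin 2 → ℂ) (a : Fin 2) (x t : ℝ) : ℕ → ℂ → Fin 2 → ℂ :=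
  fun i z => ![Φ i z x t a, Φ i z x t (1 - a)]

theorem confluentMatrix_rowSeeds (a : Fin 2) (e : ℕ → ℕ) :
    confluentMatrix n m ζ (rowSeeds Φ a x t) e = Matrix.of fun (k c : Fin (∑ i : Fin n, m i)) =>
      confluentEntry ζ Φ x t a (finSigmaFinEquiv.symm c).1 (finSigmaFinEquiv.symm c).2 (e k) := by
  ext k c
  simp only [confluentMatrix, confluentEntry, taylorCoeff, rowSeeds, Matrix.of_apply,
    Matrix.cons_val_zero, Matrix.cons_val_one]
  rw [div_eq_inv_mul]

/-- Row `s` of the triangularizing matrix consists of the coefficients of the product of the first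
`s` factors. That product has zeros at all earlier columns, and at column `s` it gives a component
of `Φ_i^{[j]}`. -/
theorem detDen_rowSeeds_ne_zero (hf : ∀ i < n, ∀ a, AnalyticAt ℂ (fun z => Φ i z x t a) (ζ i))
    (hne : ∀ i < n, ∀ j < m i, ∀ a, gdtVector m ζ Φ i j x t a ≠ 0) (a : Fin 2) :
    detDen n m ζ (rowSeeds Φ a x t) ≠ 0 := by
  rw [detDen, confluentMatrix_rowSeeds]
  let L : Fin (∑ i : Fin n, m i) → Chain := fun s =>
    gdtBefore m ζ Φ (finSigmaFinEquiv.symm s).1 (finSigmaFinEquiv.symm s).2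
  have hL : ∀ s, (L s).length = s := by
    intro s
    rw [length_gdtBefore, ← val_finSigmaFinEquiv, Equiv.apply_symm_apply]
  refine det_ne_zero_of_triangularize (fun k c => confluentEntry ζ Φ x t a
    (finSigmaFinEquiv.symm c).1 (finSigmaFinEquiv.symm c).2 k)
    (fun s k => dtCoeff (L s) a k x t) ?_ ?_
  · intro s c hcs
    rw [sum_dtCoeff_mul_confluentEntry (hf _ (Fin.is_lt _)) (hL s)]
    have hlex := lex_of_finSigmaFinEquiv_lt (m := m) (s := finSigmaFinEquiv.symm s)
      (c := finSigmaFinEquiv.symm c) (by simpa using hcs)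
    simp only [L]
    generalize finSigmaFinEquiv.symm s = s' at *
    generalize finSigmaFinEquiv.symm c = c' at *
    obtain ⟨i, j⟩ := s'
    obtain ⟨i', j'⟩ := c'
    rcases hlex with h1 | ⟨h1, h2⟩
    · exact dtTaylor_gdtBefore hf hne i'.isLt h1 _ _ j'.isLt a
    · obtain rfl := Fin.ext h1
      exact dtTaylor_gdtBefore_self hf hne i'.isLt j.isLt.le _ h2 a
  · intro c
    rw [sum_dtCoeff_mul_confluentEntry (hf _ (Fin.is_lt _)) (hL c),
      ← nextVector_eq (hf _ (Fin.is_lt _))]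
    exact hne _ (Fin.is_lt _) _ (Fin.is_lt _) a

theorem detNum_rowSeeds (hf : ∀ i < n, ∀ a, AnalyticAt ℂ (fun z => Φ i z x t a) (ζ i))
    (hne : ∀ i < n, ∀ j < m i, ∀ a, gdtVector m ζ Φ i j x t a ≠ 0) (a : Fin 2)
    (hN : 0 < ∑ i : Fin n, m i) :
    detNum n m ζ (rowSeeds Φ a x t) =
      -dtSubleading (gdtChain m ζ Φ n) a x t * detDen n m ζ (rowSeeds Φ a x t) := by
  have hl : (gdtChain m ζ Φ n).length = ∑ i : Fin n, m i := by
    rw [length_gdtChain, Finset.sum_range]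
  rw [detDen, detNum, confluentMatrix_rowSeeds, confluentMatrix_rowSeeds,
    ← dtCoeff_pred_length _ _ _ _ (List.ne_nil_of_length_pos (by omega)), hl]
  refine det_replace_last hN (fun k c => confluentEntry ζ Φ x t a (finSigmaFinEquiv.symm c).1
    (finSigmaFinEquiv.symm c).2 k) (fun k => dtCoeff (gdtChain m ζ Φ n) a k x t) ?_ ?_
  · rw [← hl]
    exact dtCoeff_length x t _ a
  · intro c
    rw [sum_dtCoeff_mul_confluentEntry (hf _ (Fin.is_lt _)) hl]
    exact dtTaylor_gdtChain hf hne (Fin.is_lt _) (Fin.is_lt _) _ (Fin.is_lt _) a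

theorem exists_ratio_eq {W : Set (ℝ × ℝ)}
    (hf : ∀ x t, (x, t) ∈ W → ∀ i < n, ∀ a, AnalyticAt ℂ (fun z => Φ i z x t a) (ζ i))
    (hne : ∀ x t, (x, t) ∈ W → ∀ i < n, ∀ j < m i, ∀ a, gdtVector m ζ Φ i j x t a ≠ 0)
    (a : Fin 2) : ∃ c, ∀ x t, (x, t) ∈ W →
      detNum n m ζ (rowSeeds Φ a x t) / detDen n m ζ (rowSeeds Φ a x t) =
        c - dtSubleading (gdtChain m ζ Φ n) a x t := by
  rcases Nat.eq_zero_or_pos (∑ i : Fin n, m i) with h | h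
  · have : IsEmpty (Fin (∑ i : Fin n, m i)) := by rw [h]; infer_instance
    have hL : gdtChain m ζ Φ n = [] := by
      rw [← List.length_eq_zero_iff, length_gdtChain, Finset.sum_range, h]
    -- For `N = 0` both determinants are `1` and `dtSubleading` is `0`. The constant is harmless,
    -- since only the derivative of the ratio is used.
    refine ⟨1, fun x t _ => ?_⟩
    rw [hL, detNum, detDen, Matrix.det_isEmpty, Matrix.det_isEmpty]
    simp [dtSubleading]
  · refine ⟨0, fun x t hx => ?_⟩
    rw [detNum_rowSeeds (hf x t hx) (hne x t hx) a h,
      mul_div_cancel_right₀ _ (detDen_rowSeeds_ne_zero (hf x t hx) (hne x t hx) a), zero_sub]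

theorem rowSeeds_zero : rowSeeds Φ 0 x t = seedsAt Φ x t := by
  ext i z a
  fin_cases a <;> rfl

end determinants

end

end KaupNewell

end

/-! ### Assembly of the theorem -/

open KaupNewell
theorem theorem3 (n : ℕ) (m : ℕ → ℕ) (ζ : ℕ → ℂ)
    (W : Set (ℝ × ℝ)) (hW : IsOpen W)
    (u v : ℝ → ℝ → ℂ) (hu : SmoothField W u) (hv : SmoothField W v) (hKN : IsKNSol W u v)
    (Φ : ℕ → ℂ → ℝ → ℝ → Fin 2 → ℂ)
    (hΦ : ∀ i < n, IsSeed W u v (ζ i) (Φ i))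
    -- every factor `D_i^{[j]}` is well defined on `W`
    (hne : ∀ i < n, ∀ j < m i, ∀ x t : ℝ, (x, t) ∈ W →
      gdtVector m ζ Φ i j x t 0 ≠ 0 ∧ gdtVector m ζ Φ i j x t 1 ≠ 0)
    (N : ℕ) (hN : N = ∑ i : Fin n, m i)
    (DN : ℂ → ℝ → ℝ → Matrix (Fin 2) (Fin 2) ℂ) (hDN : DN = dtProd (gdtChain m ζ Φ n))
    (uN vN : ℝ → ℝ → ℂ)
    (huN : uN = (dtFields u v (gdtChain m ζ Φ n)).1)
    (hvN : vN = (dtFields u v (gdtChain m ζ Φ n)).2) :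
    -- the new seeds are the limits and solve the Lax pair of the step reached
    (∀ i < n, ∀ j < m i,
      (∀ x t : ℝ, (x, t) ∈ W →
        Filter.Tendsto
          (fun ε : ℂ => (ε ^ j)⁻¹ •
            (dtProd (gdtBefore m ζ Φ i j) (ζ i + ε) x t *ᵥ Φ i (ζ i + ε) x t))
          (𝓝[≠] 0) (𝓝 (gdtVector m ζ Φ i j x t))) ∧
      IsLaxSol W (dtFields u v (gdtBefore m ζ Φ i j)).1 (dtFields u v (gdtBefore m ζ Φ i j)).2
        (ζ i) (gdtVector m ζ Φ i j)) ∧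
    -- the product has `N` factors and its zeros are those prescribed
    (gdtChain m ζ Φ n).length = N ∧
    (∀ x t : ℝ, (x, t) ∈ W → ∀ z : ℂ,
      (DN z x t).det = ∏ i : Fin n, (ζ i ^ 2 - z ^ 2) ^ m i) ∧
    (∀ i < n, ∀ x t : ℝ, (x, t) ∈ W → ∀ k < m i,
      iteratedDeriv k (fun z => DN z x t *ᵥ Φ i z x t) (ζ i) = 0) ∧
    -- the product is a Darboux matrix from `(u, v)` to `(uN, vN)`
    SmoothField W uN ∧ SmoothField W vN ∧ IsKNSol W uN vN ∧
    (∀ z : ℂ, z ≠ 0 → ∀ x t : ℝ, (x, t) ∈ W → ∀ a b : Fin 2,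
      HasDerivAt (fun y : ℝ => DN z y t a b)
        ((laxU uN vN z x t * DN z x t - DN z x t * laxU u v z x t) a b) x ∧
      HasDerivAt (fun s : ℝ => DN z x s a b)
        ((laxV uN vN z x t * DN z x t - DN z x t * laxV u v z x t) a b) t) ∧
    (∀ z : ℂ, z ≠ 0 → ∀ Ψ : ℝ → ℝ → Fin 2 → ℂ, IsLaxSol W u v z Ψ →
      IsLaxSol W uN vN z (fun x t => DN z x t *ᵥ Ψ x t)) ∧
    -- the determinant formulas for the fields
    (∀ x t : ℝ, (x, t) ∈ W →
      detDen n m ζ (seedsAt Φ x t) ≠ 0 ∧ detDen n m ζ (swappedAt Φ x t) ≠ 0 ∧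
      DifferentiableAt ℝ (fun y : ℝ => ratio n m ζ Φ y t) x ∧
      DifferentiableAt ℝ (fun y : ℝ => ratioSwapped n m ζ Φ y t) x ∧
      (Odd N → uN x t = v x t - dX (ratio n m ζ Φ) x t ∧
        vN x t = u x t - dX (ratioSwapped n m ζ Φ) x t) ∧
      (Even N → uN x t = u x t - dX (ratio n m ζ Φ) x t ∧
        vN x t = v x t - dX (ratioSwapped n m ζ Φ) x t)) := by
  subst hN hDN huN hvN
  have hne' : ∀ i < n, ∀ j < m i, ∀ x t : ℝ, (x, t) ∈ W → ∀ a,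
      gdtVector m ζ Φ i j x t a ≠ 0 := fun i hi j hj x t hx =>
    Fin.forall_fin_two.2 (hne i hi j hj x t hx)
  have hneP : ∀ x t : ℝ, (x, t) ∈ W → ∀ i < n, ∀ j < m i, ∀ a,
      gdtVector m ζ Φ i j x t a ≠ 0 := fun x t hx i hi j hj => hne' i hi j hj x t hx
  have hf : ∀ x t : ℝ, (x, t) ∈ W → ∀ i < n, ∀ a,
      AnalyticAt ℂ (fun z => Φ i z x t a) (ζ i) := fun x t hx i hi => (hΦ i hi).analyticAt hx
  have hchain := isDarbouxChain_gdtChain hW hu hv hΦ hne'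
  have hlen : (gdtChain m ζ Φ n).length = ∑ i : Fin n, m i := by
    rw [length_gdtChain, Finset.sum_range]
  have hfields := hchain.smooth_fields hW hu hv
  refine ⟨fun i hi j hj => ⟨fun x t hx => ?_, ?_⟩, hlen,
    fun x t hx z => det_gdtChain z (hneP x t hx), fun i hi x t hx k hk => ?_, hfields.1, hfields.2,
    hchain.isKNSol hW hu hv hKN, fun z hz => hchain.intertwines hW hu hv hz,
    fun z hz Ψ hΨ => (hchain.intertwines hW hu hv hz).isLaxSol hΨ, fun x t hx => ?_⟩
  · rw [gdtVector, nextVector_eq (hf x t hx i hi), tendsto_pi_nhds]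
    exact fun a => tendsto_of_taylorCoeff (analyticAt_dtProd_mulVec (hf x t hx i hi) _ x t a)
      fun k hk => dtTaylor_gdtBefore_self (hf x t hx) (hneP x t hx) hi hj.le k hk a
  -- The head of the chain with `j + 1` steps carries the Lax solution property of the vector of
  -- index `j`.
  · exact (isDarbouxChain_gdtBefore hW hu hv hΦ hne' hi (j + 1) hj).2.isLaxSol
  · ext a
    rw [iteratedDeriv_apply (analyticAt_dtProd_mulVec (hf x t hx i hi) _ x t), Pi.zero_apply,
      ← taylorCoeff_eq_zero_iff]
    exact dtTaylor_gdtChain (hf x t hx) (hneP x t hx) hi hi k hk a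
  · have hden := detDen_rowSeeds_ne_zero (hf x t hx) (hneP x t hx)
    have hratio : ∀ a, HasDerivAt (fun y => detNum n m ζ (rowSeeds Φ a y t)
        / detDen n m ζ (rowSeeds Φ a y t)) (-dX (dtSubleading (gdtChain m ζ Φ n) a) x t) x := by
      intro a
      obtain ⟨c, hc⟩ := exists_ratio_eq hf hneP a
      exact (((hchain.smooth_dtSubleading a).hasDerivAt_dX hW hx).const_sub c).congr_of_eventuallyEq
        ((eventually_mem_x hW hx).mono fun y hy => hc y t hy)
    have h0 : HasDerivAt (fun y => ratio n m ζ Φ y t)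
        (-dX (dtSubleading (gdtChain m ζ Φ n) 0) x t) x := by
      simpa only [ratio, rowSeeds_zero] using hratio 0
    -- `rowSeeds Φ 1` agrees with `swappedAt Φ` by definition, as `1 - 1` computes to `0` in `Fin
    -- 2`.
    have h1 : HasDerivAt (fun y => ratioSwapped n m ζ Φ y t)
        (-dX (dtSubleading (gdtChain m ζ Φ n) 1) x t) x := hratio 1
    have heq := hchain.dtFields_eq hW x t hx
    rw [hlen] at heq
    refine ⟨rowSeeds_zero (Φ := Φ) ▸ hden 0, hden 1, h0.differentiableAt, h1.differentiableAt, ?_⟩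
    rw [show dX (ratio n m ζ Φ) x t = _ from h0.deriv,
      show dX (ratioSwapped n m ζ Φ) x t = _ from h1.deriv, heq.1, heq.2]
    constructor
    · intro hodd
      rw [if_neg (Nat.not_even_iff_odd.2 hodd), if_neg (Nat.not_even_iff_odd.2 hodd)]
      constructor <;> ring
    · intro heven
      rw [if_pos heven, if_pos heven]
      constructor <;> ring
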